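/- Let $k$ be a field of characteristic $0$, let $n\ge 0$, and let $q_{i,j}\in k^*$ ($1\le i,j\le n$) satisfy $q_{j,i}=q_{i,j}^{-1}$ and $q_{i,i}=-1$. Let $$\Lambda=\Lambda_{\mathbf q}=k\langle x_1,\dots,x_n\mid x_ix_j=-q_{i,j}x_jx_i\ (i<j),\ x_i^2=0\ (\text{all } i)\rangle .$$ Let $G$ be a finite group acting on $\Lambda$ by $k$-algebra automorphisms with ${}^g x_i=\chi_{g,i}x_i$, $\chi_{g,i}\in k$, for all $g\in G$ and all $i$. Let $\Lambda\rtimes G$ be the skew group algebra, i.e. $\Lambda\otimes kG$ with $(a\otimes g)(b\otimes h)=a\,({}^g b)\otimes gh$; for $g\in G$ let $\Lambda\otimes g\subseteq\Lambda\rtimes G$ be the sub-$\Lambda$-bimodule of all $a\otimes g$. For a $k$-algebra $A$ put $A^e=A\otimes A^{op}$, $\mathrm{HH}^m(A,M)=\mathrm{Ext}^m_{A^e}(A,M)$ for an $A$-bimodule $M$, and $\mathrm{HH}^m(A)=\mathrm{HH}^m(A,A)$. For $\alpha\in\{0,1\}^n$ write $x^\alpha=x_1^{\alpha_1}\cdots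 x_n^{\alpha_n}$; for $\beta\in\mathbb N^n$ write $|\beta|=\sum_i\beta_i$; let $[j]$ be the $j$-th unit vector. Let $\mathbb K$ be the complex with $\mathbb K_m=\bigoplus_{|\beta|=m}\Lambda\epsilon_\beta\Lambda$ (the free $\Lambda$-bimodule on the symbols $\epsilon_\beta$ with $|\beta|=m$) and differential $$\delta(\epsilon_\beta)=\sum_{j:\ \beta_j>0}\Big(\prod_{l<j}q_{l,j}^{\beta_l}\;x_j\,\epsilon_{\beta-[j]}+(-1)^{\sum_{l\le j}\beta_l}\prod_{l>j}(-q_{j,l})^{\beta_l}\;\epsilon_{\beta-[j]}\,x_j\Big),$$ augmented by $\mathbb K_0\to\Lambda$, $\epsilon_0\mapsto 1$. For $|\beta|=m$ let $(x^\alpha\otimes g)\epsilon_\beta^*:\mathbb K_m\to\Lambda\otimes g$ be the bimodule map sending $\epsilon_\beta$ to $x^\alpha\otimes g$ and $\epsilon_{\beta'}$ to $0$ for $\beta'\neq\beta$. For $g\in G$ let $$C_g=\Big\{\gamma\in(\mathbb N\cup\{-1\})^n \;\Big|\; \text{for every } l:\ \gamma_l=-1\ \text{ or }\ (-1)^{\gamma_l}\prod_{i\ne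 l}(-q_{i,l})^{\gamma_i}=\chi_{g,l}\Big\}.$$ Then $\mathbb K$ with this augmentation is a projective resolution of the $\Lambda$-bimodule $\Lambda$, and for every $m\ge 0$: 1. For each $g\in G$, the maps $(x^\alpha\otimes g)\epsilon_\beta^*$ with $\alpha\in\{0,1\}^n$, $\beta\in\mathbb N^n$, $|\beta|=m$ and $\beta-\alpha\in C_g$ are cocycles, and their classes form a $k$-basis of $\mathrm{HH}^m(\Lambda,\Lambda\otimes g)$; that is, $$\mathrm{HH}^m(\Lambda,\Lambda\otimes g)\cong\bigoplus_{\substack{\beta\in\mathbb N^n\\ |\beta|=m}}\ \bigoplus_{\substack{\alpha\in\{0,1\}^n\\ \beta-\alpha\in C_g}}\mathrm{span}_k\{(x^\alpha\otimes g)\epsilon_\beta^*\}.$$ 2. The images of all these classes, $g\in G$, form a $k$-basis of $\mathrm{HH}^m(\Lambda,\Lambda\rtimes G)=\bigoplus_{g\in G}\mathrm{HH}^m(\Lambda,\Lambda\otimes g)$, and the restriction map $\mathrm{HH}^m(\Lambda\rtimes G)\to\mathrm{HH}^m(\Lambda,\Lambda\rtimes G)$ along $\Lambda\subseteq\Lambda\rtimes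 G$ is injective with image the $G$-invariant subspace, where $h\in G$ acts on $\mathrm{HH}^m(\Lambda,\Lambda\rtimes G)$ through its action on $\Lambda$ and by conjugation on $\Lambda\rtimes G$ (on bar cochains: $f\mapsto h\,f({}^{h^{-1}}-,\dots,{}^{h^{-1}}-)\,h^{-1}$). Thus $\mathrm{HH}^m(\Lambda\rtimes G)$ is the $G$-invariant subspace of $$\bigoplus_{g\in G}\ \bigoplus_{\substack{\beta\in\mathbb N^n\\ |\beta|=m}}\ \bigoplus_{\substack{\alpha\in\{0,1\}^n\\ \beta-\alpha\in C_g}}\mathrm{span}_k\{(x^\alpha\otimes g)\epsilon_\beta^*\}.$$ -/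

import Mathlib

open CategoryTheory TensorProduct

universe u

noncomputable section

namespace HHQuantum

/-! ### Bimodules and Hochschild cohomology -/

section Bimodules

variable (k : Type u) [Field k]

/-- The tensor product of two `k`-algebras. -/
abbrev AlgTensor (A B : Type u) [Ring A] [Algebra k A] [Ring B] [Algebra k B] : Type u := A ⊗[k] B

/-- The enveloping algebra `A ⊗ A^op`; its left modules are the `A`-bimodules. -/
abbrev Env (A : Type u) [Ring A] [Algebra k A] : Type u := AlgTensor k A Aᵐᵒᵖ

/-- `A` as a bimodule over itself: `(a ⊗ b) • c = a * c * b`. -/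
def selfBimod (A : Type u) [Ring A] [Algebra k A] : ModuleCat.{u} (Env k A) :=
  letI : Module (Env k A) A := TensorProduct.Algebra.module
  ModuleCat.of (Env k A) A

/-- Hochschild cohomology `HH^m(A, M) = Ext^m_{A ⊗ A^op}(A, M)`. -/
abbrev HH (A : Type u) [Ring A] [Algebra k A] (M : ModuleCat.{u} (Env k A)) (m : ℕ) : Type u :=
  Abelian.Ext.{u} (selfBimod k A) M m

variable {k}

/-- The algebra map `A ⊗ A^op → B ⊗ B^op` induced by an algebra map `A → B`. -/
def envMap {A B : Type u} [Ring A] [Algebra k A] [Ring B] [Algebra k B] (f : A →ₐ[k] B) :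
    Env k A →ₐ[k] Env k B :=
  Algebra.TensorProduct.map f (AlgHom.op f)

/-- Restriction of bimodules along an algebra map `A → B`. -/
abbrev resBimod {A B : Type u} [Ring A] [Algebra k A] [Ring B] [Algebra k B] (f : A →ₐ[k] B) :
    ModuleCat.{u} (Env k B) ⥤ ModuleCat.{u} (Env k A) :=
  ModuleCat.restrictScalars (envMap f).toRingHom

variable (k) in
/-- An element of `A`, viewed in the bimodule `A`. -/
def selfElt {A : Type u} [Ring A] [Algebra k A] (c : A) : selfBimod k A := c

lemma smul_selfElt {A : Type u} [Ring A] [Algebra k A] (a : A) (b : Aᵐᵒᵖ) (c : A) :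
    (a ⊗ₜ[k] b : Env k A) • selfElt k c = selfElt k (a * c * b.unop) := by
  change a * (c * b.unop) = _
  rw [← mul_assoc]
  rfl

lemma restrictScalars_map_exact {R S : Type u} [Ring R] [Ring S] (f : R →+* S)
    (T : ShortComplex (ModuleCat.{u} S)) (h : T.Exact) :
    (T.map (ModuleCat.restrictScalars.{u} f)).Exact := by
  rw [CategoryTheory.ShortComplex.ShortExact.moduleCat_exact_iff_function_exact] at h ⊢
  exact h

instance restrictScalars_preservesFiniteLimits {R S : Type u} [Ring R] [Ring S] (f : R →+* S) :
    Limits.PreservesFiniteLimits (ModuleCat.restrictScalars.{u} f) := by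
  have := ((CategoryTheory.Functor.exact_tfae (ModuleCat.restrictScalars.{u} f)).out 1 3).mp
    (restrictScalars_map_exact f)
  exact this.1

instance restrictScalars_preservesFiniteColimits {R S : Type u} [Ring R] [Ring S] (f : R →+* S) :
    Limits.PreservesFiniteColimits (ModuleCat.restrictScalars.{u} f) := by
  have := ((CategoryTheory.Functor.exact_tfae (ModuleCat.restrictScalars.{u} f)).out 1 3).mp
    (restrictScalars_map_exact f)
  exact this.2

/-- An additive map that commutes with the action of pure tensors is a map of bimodules. -/
def mkBimodHom {A : Type u} [Ring A] [Algebra k A] {M N : ModuleCat.{u} (Env k A)}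
    (φ : M →+ N)
    (h : ∀ (a : A) (b : Aᵐᵒᵖ) (c : M),
      φ ((a ⊗ₜ[k] b : Env k A) • c) = (a ⊗ₜ[k] b : Env k A) • φ c) : M ⟶ N :=
  ModuleCat.ofHom
    { toFun := φ
      map_add' := map_add φ
      map_smul' := fun r c => by
        induction r using TensorProduct.induction_on with
        | zero =>
          exact (congrArg φ (zero_smul (Env k A) c)).trans
            ((map_zero φ).trans (zero_smul (Env k A) (φ c)).symm)
        | tmul a b => exact h a b c
        | add x y hx hy =>
          simp only [add_smul, map_add, RingHom.id_apply] at hx hy ⊢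
          rw [hx, hy] }

/-- An algebra map `f : A → B`, as a map of `A`-bimodules. -/
def resBimodUnit {A B : Type u} [Ring A] [Algebra k A] [Ring B] [Algebra k B] (f : A →ₐ[k] B) :
    selfBimod k A ⟶ (resBimod f).obj (selfBimod k B) :=
  mkBimodHom (M := selfBimod k A) (N := (resBimod f).obj (selfBimod k B))
    (show A →+ B from (f : A →+ B)) (fun a b c => by
      change f (a * ((show A from c) * b.unop)) = f a * (f c * f b.unop)
      rw [map_mul, map_mul])

/-- For an algebra map `f : A → B` and a `B`-bimodule `M`, the restriction map
`HH^m(B, M) → HH^m(A, M)`: restrict an extension class of `B`-bimodules to `A`-bimodules and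
pull it back along `f : A → B`. -/
def resHH {A B : Type u} [Ring A] [Algebra k A] [Ring B] [Algebra k B] (f : A →ₐ[k] B)
    (M : ModuleCat.{u} (Env k B)) (m : ℕ) :
    HH k B M m →ₗ[k] HH k A ((resBimod f).obj M) m where
  toFun e := (Abelian.Ext.mk₀ (resBimodUnit f)).comp (e.mapExactFunctor (resBimod f)) (zero_add m)
  map_add' e e' := by simp
  map_smul' c e := by simp

end Bimodules

/-! ### Skew group algebras -/

section Skew

variable (k : Type u) [Field k] (A : Type u) [Ring A] [Algebra k A]
variable (G : Type u) [Group G] [MulSemiringAction G A] [SMulCommClass G k A]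

/-- The inclusion `A → A ⋊ G`, `a ↦ a ⊗ 1`. The skew group algebra `A ⋊ G` is Mathlib's
`SkewMonoidAlgebra A G`; `a ⊗ g` is `single g a`, and
`single g a * single h b = single (g * h) (a * g • b)`. -/
def skewIncl : A →ₐ[k] SkewMonoidAlgebra A G :=
  { SkewMonoidAlgebra.singleOneRingHom with
    commutes' := fun _ => rfl }

/-- `A ⋊ G` as an `A`-bimodule. -/
abbrev skewBimod : ModuleCat.{u} (Env k A) :=
  (resBimod (skewIncl k A G)).obj (selfBimod k (SkewMonoidAlgebra A G))

variable {G}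

lemma incl_aux (g : G) (a b c : A) :
    SkewMonoidAlgebra.single g (a * (c * g • b)) =
      SkewMonoidAlgebra.single 1 a *
        (SkewMonoidAlgebra.single g c * SkewMonoidAlgebra.single 1 b) := by
  simp [SkewMonoidAlgebra.single_mul_single]

lemma conj_aux (h : G) (a b : A) (c : SkewMonoidAlgebra A G) :
    SkewMonoidAlgebra.single h (1 : A) *
        (SkewMonoidAlgebra.single 1 (h⁻¹ • a) * (c * SkewMonoidAlgebra.single 1 (h⁻¹ • b))) *
          SkewMonoidAlgebra.single h⁻¹ (1 : A) =
      SkewMonoidAlgebra.single 1 a *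
        ((SkewMonoidAlgebra.single h (1 : A) * c * SkewMonoidAlgebra.single h⁻¹ (1 : A)) *
          SkewMonoidAlgebra.single 1 b) := by
  have h1 : SkewMonoidAlgebra.single h (1 : A) * SkewMonoidAlgebra.single 1 (h⁻¹ • a) =
      SkewMonoidAlgebra.single 1 a * SkewMonoidAlgebra.single h (1 : A) := by
    simp [SkewMonoidAlgebra.single_mul_single]
  have h2 : SkewMonoidAlgebra.single 1 (h⁻¹ • b) * SkewMonoidAlgebra.single h⁻¹ (1 : A) =
      SkewMonoidAlgebra.single h⁻¹ (1 : A) * SkewMonoidAlgebra.single 1 b := by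
    simp [SkewMonoidAlgebra.single_mul_single]
  rw [← mul_assoc, h1]
  simp only [mul_assoc]
  rw [h2]

/-- The `A`-bimodule `A ⊗ g`, with underlying space `A` and
`(a ⊗ b) • c = a * c * (g • b)`; this is the sub-bimodule of `A ⋊ G` consisting of all
`c ⊗ g`, see `twistIncl`. -/
def twistBimod (g : G) : ModuleCat.{u} (Env k A) :=
  (ModuleCat.restrictScalars
    (Algebra.TensorProduct.map (AlgHom.id k A)
      (AlgHom.op (MulSemiringAction.toAlgHom k A g))).toRingHom).obj (selfBimod k A)

/-- The element `c ⊗ g` of `A ⊗ g`. -/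
def twistElt (g : G) (c : A) : twistBimod k A g := c

/-- The inclusion of `A ⊗ g` in `A ⋊ G`. -/
def twistIncl (g : G) : twistBimod k A g ⟶ skewBimod k A G :=
  mkBimodHom (M := twistBimod k A g) (N := skewBimod k A G)
    (show A →+ SkewMonoidAlgebra A G from SkewMonoidAlgebra.singleAddHom g)
    (fun a b c => incl_aux A g a b.unop c)

/-- Conjugation `s ↦ h s h⁻¹` on `A ⋊ G`, a map of `A`-bimodules once the source is twisted
by `h⁻¹` on both sides. -/
def skewConj (h : G) :
    (resBimod (MulSemiringAction.toAlgHom k A h⁻¹)).obj (skewBimod k A G) ⟶ skewBimod k A G :=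
  mkBimodHom (M := (resBimod (MulSemiringAction.toAlgHom k A h⁻¹)).obj (skewBimod k A G))
    (N := skewBimod k A G)
    (show SkewMonoidAlgebra A G →+ SkewMonoidAlgebra A G from
      (AddMonoidHom.mulRight (SkewMonoidAlgebra.single h⁻¹ (1 : A))).comp
        (AddMonoidHom.mulLeft (SkewMonoidAlgebra.single h (1 : A))))
    (fun a b c => conj_aux A h a b.unop c)

/-- The action of `h ∈ G` on `HH^m(A, A ⋊ G)`, induced by `h` acting on `A` and by conjugation
on `A ⋊ G`: the composite `A → A' → (A ⋊ G)' → A ⋊ G`, where `'` is restriction along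
`h⁻¹ ⊗ h⁻¹`, the first map is `h⁻¹`, the middle one is the restricted extension class and the
last one is conjugation by `h`. In degree zero, and on bar cochains, it is
`f ↦ h f(h⁻¹ -) h⁻¹`. -/
def skewAct (m : ℕ) (h : G) :
    HH k A (skewBimod k A G) m →ₗ[k] HH k A (skewBimod k A G) m where
  toFun e := (Abelian.Ext.mk₀ (resBimodUnit (MulSemiringAction.toAlgHom k A h⁻¹))).comp
    ((e.mapExactFunctor (resBimod (MulSemiringAction.toAlgHom k A h⁻¹))).comp
      (Abelian.Ext.mk₀ (skewConj k A h)) (add_zero m)) (zero_add m)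
  map_add' e e' := by simp
  map_smul' c e := by simp

variable (G)

/-- The `G`-invariants `HH^m(A, A ⋊ G)^G`. -/
def skewInvariants (m : ℕ) : Submodule k (HH k A (skewBimod k A G) m) :=
  ⨅ h : G, LinearMap.eqLocus (skewAct k A m h) LinearMap.id

end Skew

/-! ### Quantum complete intersections with all exponents two -/

section Quantum

/-- Quantum coefficients: nonzero `q i j` with `q j i = (q i j)⁻¹` and `q i i = -1`. -/
structure QCoeff (k : Type u) [Field k] (n : ℕ) where
  val : Fin n → Fin n → k
  ne_zero : ∀ i j, val i j ≠ 0
  symm : ∀ i j, val j i = (val i j)⁻¹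
  diag : ∀ i, val i i = -1

variable {k : Type u} [Field k] {n : ℕ}

/-- The relations `x_i x_j = - q_{i,j} x_j x_i` for `i < j` and `x_i ^ 2 = 0`. -/
inductive QRel (q : QCoeff k n) : FreeAlgebra k (Fin n) → FreeAlgebra k (Fin n) → Prop
  | comm (i j : Fin n) (h : i < j) :
      QRel q (FreeAlgebra.ι k i * FreeAlgebra.ι k j)
        (-(q.val i j • (FreeAlgebra.ι k j * FreeAlgebra.ι k i)))
  | sq (i : Fin n) : QRel q (FreeAlgebra.ι k i * FreeAlgebra.ι k i) 0

/-- The quantum complete intersection `Λ_q`. -/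
def QCI (q : QCoeff k n) : Type u := RingQuot (QRel q)

namespace QCI

instance instRing (q : QCoeff k n) : Ring (QCI q) := inferInstanceAs (Ring (RingQuot (QRel q)))

instance instAlgebra (q : QCoeff k n) : Algebra k (QCI q) :=
  inferInstanceAs (Algebra k (RingQuot (QRel q)))

/-- The quotient map from the free algebra. -/
def mk (q : QCoeff k n) : FreeAlgebra k (Fin n) →ₐ[k] QCI q := RingQuot.mkAlgHom k (QRel q)

lemma mk_rel (q : QCoeff k n) {a b : FreeAlgebra k (Fin n)} (h : QRel q a b) :
    mk q a = mk q b := RingQuot.mkAlgHom_rel k h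

variable (q : QCoeff k n)

/-- The generator `x_i`. -/
def x (i : Fin n) : QCI q := mk q (FreeAlgebra.ι k i)

/-- The monomial `x^α = x_1^{α_1} ⋯ x_n^{α_n}`, for `α ∈ {0,1}^n`. -/
def mono (α : Fin n → Fin 2) : QCI q := (List.ofFn fun i => x q i ^ (α i : ℕ)).prod

lemma x_mul_self (i : Fin n) : x q i * x q i = 0 := by
  rw [x, ← map_mul, mk_rel q (QRel.sq (q := q) i), map_zero]

lemma x_mul_x {i j : Fin n} (h : i < j) : x q i * x q j = -(q.val i j • (x q j * x q i)) := by
  rw [x, x, ← map_mul, mk_rel q (QRel.comm (q := q) i j h), map_neg, map_smul,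
    map_mul]

/-! ### The resolution `K` -/

/-- `β - [j]` for `β_j > 0`. -/
def dec (β : Fin n → ℕ) (j : Fin n) : Fin n → ℕ := Function.update β j (β j - 1)

/-- The coefficient `∏_{l<j} q_{l,j}^{β_l}`. -/
def cL (β : Fin n → ℕ) (j : Fin n) : k := ∏ l ∈ Finset.Iio j, q.val l j ^ β l

/-- The coefficient `(-1)^{∑_{l≤j} β_l} ∏_{l>j} (-q_{j,l})^{β_l}`. -/
def cR (β : Fin n → ℕ) (j : Fin n) : k :=
  (-1) ^ (∑ l ∈ Finset.Iic j, β l) * ∏ l ∈ Finset.Ioi j, (-q.val j l) ^ β l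

/-- Multi-indices `β ∈ ℕ^n` with `|β| = m`. -/
abbrev MIdx (n m : ℕ) : Type := {β : Fin n → ℕ // ∑ i, β i = m}

/-- The free bimodule `K_m = ⨁_{|β| = m} Λ_q ε_β Λ_q`. -/
abbrev KX (m : ℕ) : Type u := MIdx n m →₀ Env k (QCI q)

/-- The generator `ε_β` of `K_m` if `|β| = m`, and zero otherwise. -/
def eps (m : ℕ) (β : Fin n → ℕ) : KX q m :=
  if h : ∑ i, β i = m then Finsupp.single ⟨β, h⟩ 1 else 0

/-- The element `∏_{l<j} q_{l,j}^{β_l} x_j ⊗ 1 + (-1)^{∑_{l≤j} β_l} ∏_{l>j} (-q_{j,l})^{β_l} 1 ⊗ x_j`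
of the enveloping algebra. -/
def cof (β : Fin n → ℕ) (j : Fin n) : Env k (QCI q) :=
  cL q β j • (x q j ⊗ₜ[k] 1) + cR q β j • (1 ⊗ₜ[k] MulOpposite.op (x q j))

/-- The differential of `K` on `ε_β`: the sum over `j` with `β_j > 0` of
`∏_{l<j} q_{l,j}^{β_l} x_j ε_{β-[j]} + (-1)^{∑_{l≤j} β_l} ∏_{l>j} (-q_{j,l})^{β_l} ε_{β-[j]} x_j`. -/
def dEps (m : ℕ) (β : Fin n → ℕ) : KX q m :=
  ∑ j, if β j = 0 then 0 else cof q β j • eps q m (dec β j)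

/-- The differential `K_{m+1} → K_m`. -/
def dK (m : ℕ) : KX q (m + 1) →ₗ[Env k (QCI q)] KX q m :=
  Finsupp.linearCombination (Env k (QCI q)) fun β : MIdx n (m + 1) => dEps q m β.1

lemma dK_eps (m : ℕ) (β : Fin n → ℕ) (h : ∑ i, β i = m + 1) :
    dK q m (eps q (m + 1) β) = dEps q m β := by
  simp [dK, eps, h]

lemma dec_ne {β : Fin n → ℕ} {i l : Fin n} (h : i ≠ l) : dec β l i = β i := by
  simp [dec, h]

lemma dec_self (β : Fin n → ℕ) {l : Fin n} (hl : β l ≠ 0) : β l = dec β l l + 1 := by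
  simp [dec]
  omega

lemma dec_comm (β : Fin n → ℕ) {j l : Fin n} (h : l ≠ j) :
    dec (dec β j) l = dec (dec β l) j := by
  rw [dec, dec_ne h, dec, dec, dec_ne h.symm, dec, Function.update_comm h.symm]

lemma sum_dec (s : Finset (Fin n)) {β : Fin n → ℕ} {l : Fin n} (hl : β l ≠ 0)
    (hs : l ∈ s) : ∑ i ∈ s, β i = ∑ i ∈ s, (dec β l) i + 1 := by
  rw [← Finset.add_sum_erase s _ hs, ← Finset.add_sum_erase s (dec β l) hs,
    Finset.sum_congr rfl fun i hi => dec_ne (β := β) (Finset.ne_of_mem_erase hi)]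
  have := dec_self β hl
  omega

lemma cL_of_le {β : Fin n → ℕ} {j l : Fin n} (h : j ≤ l) :
    cL q (dec β l) j = cL q β j := by
  refine Finset.prod_congr rfl fun i hi => ?_
  rw [dec_ne ((Finset.mem_Iio.1 hi).trans_le h).ne]

lemma cL_of_lt {β : Fin n → ℕ} {j l : Fin n} (h : l < j) (hl : β l ≠ 0) :
    cL q β j = q.val l j * cL q (dec β l) j := by
  have hs : l ∈ Finset.Iio j := Finset.mem_Iio.2 h
  have h1 : ∏ i ∈ (Finset.Iio j).erase l, q.val i j ^ dec β l i =
      ∏ i ∈ (Finset.Iio j).erase l, q.val i j ^ β i :=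
    Finset.prod_congr rfl fun i hi => by rw [dec_ne (Finset.ne_of_mem_erase hi)]
  rw [cL, cL, ← Finset.mul_prod_erase _ _ hs, ← Finset.mul_prod_erase (Finset.Iio j)
    (fun i => q.val i j ^ dec β l i) hs, h1, dec_self β hl, pow_succ']
  simp only [mul_assoc]

lemma cR_of_le {β : Fin n → ℕ} {j l : Fin n} (h : l ≤ j) (hl : β l ≠ 0) :
    cR q β j = -cR q (dec β l) j := by
  have h1 : ∏ i ∈ Finset.Ioi j, (-q.val j i) ^ dec β l i =
      ∏ i ∈ Finset.Ioi j, (-q.val j i) ^ β i :=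
    Finset.prod_congr rfl fun i hi => by rw [dec_ne (h.trans_lt (Finset.mem_Ioi.1 hi)).ne']
  rw [cR, cR, sum_dec (Finset.Iic j) hl (Finset.mem_Iic.2 h), pow_succ, h1]
  simp only [mul_neg, mul_one, neg_mul]

lemma cR_of_lt {β : Fin n → ℕ} {j l : Fin n} (h : j < l) (hl : β l ≠ 0) :
    cR q β j = -q.val j l * cR q (dec β l) j := by
  have hs : l ∈ Finset.Ioi j := Finset.mem_Ioi.2 h
  have h1 : ∏ i ∈ (Finset.Ioi j).erase l, (-q.val j i) ^ dec β l i =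
      ∏ i ∈ (Finset.Ioi j).erase l, (-q.val j i) ^ β i :=
    Finset.prod_congr rfl fun i hi => by rw [dec_ne (Finset.ne_of_mem_erase hi)]
  have h2 : ∑ i ∈ Finset.Iic j, dec β l i = ∑ i ∈ Finset.Iic j, β i :=
    Finset.sum_congr rfl fun i hi => dec_ne ((Finset.mem_Iic.1 hi).trans_lt h).ne
  rw [cR, cR, ← Finset.mul_prod_erase _ _ hs, ← Finset.mul_prod_erase (Finset.Ioi j)
    (fun i => (-q.val j i) ^ dec β l i) hs, h1, h2, dec_self β hl, pow_succ']
  ring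

lemma cof_mul_self {β : Fin n → ℕ} {j : Fin n} (hj : β j ≠ 0) :
    cof q β j * cof q (dec β j) j = 0 := by
  have h1 : MulOpposite.op (x q j) * MulOpposite.op (x q j) = 0 := by
    rw [← MulOpposite.op_mul, x_mul_self, MulOpposite.op_zero]
  rw [cof, cof, cL_of_le q le_rfl, cR_of_le q le_rfl hj]
  simp only [mul_add, add_mul, smul_mul_smul_comm, Algebra.TensorProduct.tmul_mul_tmul, one_mul,
    mul_one, x_mul_self, h1, TensorProduct.zero_tmul, TensorProduct.tmul_zero, smul_zero,
    zero_add, add_zero, ← add_smul]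
  rw [mul_comm]
  simp

lemma cof_mul_of_lt {β : Fin n → ℕ} {j l : Fin n} (h : l < j) (hj : β j ≠ 0) (hl : β l ≠ 0) :
    cof q β j * cof q (dec β j) l + cof q β l * cof q (dec β l) j = 0 := by
  have h1 : MulOpposite.op (x q l) * MulOpposite.op (x q j) =
      MulOpposite.op (x q j * x q l) := rfl
  have h3 : x q l * x q j = (-q.val l j) • (x q j * x q l) := by
    rw [x_mul_x q h, neg_smul]
  have h2 : MulOpposite.op (x q j) * MulOpposite.op (x q l) =
      (-q.val l j) • MulOpposite.op (x q j * x q l) := by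
    rw [← MulOpposite.op_mul, h3]; rfl
  rw [cof, cof, cof, cof, cL_of_le q h.le, cL_of_lt q h hl, cR_of_le q h.le hl, cR_of_lt q h hj]
  simp only [mul_add, add_mul, smul_mul_smul_comm, Algebra.TensorProduct.tmul_mul_tmul, one_mul,
    mul_one, h1, h2, h3, ← TensorProduct.smul_tmul', TensorProduct.tmul_smul]
  module

lemma cof_mul {β : Fin n → ℕ} {j l : Fin n} (h : l ≠ j) (hj : β j ≠ 0) (hl : β l ≠ 0) :
    cof q β j * cof q (dec β j) l + cof q β l * cof q (dec β l) j = 0 := by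
  rcases lt_or_gt_of_ne h with h | h
  · exact cof_mul_of_lt q h hj hl
  · rw [add_comm]; exact cof_mul_of_lt q h hl hj

lemma dK_dEps (m : ℕ) (β : Fin n → ℕ) (h : ∑ i, β i = m + 2) :
    dK q m (dEps q (m + 1) β) = 0 := by
  have key : dK q m (dEps q (m + 1) β) = ∑ p : Fin n × Fin n,
      if β p.1 = 0 ∨ (dec β p.1) p.2 = 0 then 0 else
        (cof q β p.1 * cof q (dec β p.1) p.2) •
          eps q m (dec (dec β p.1) p.2) := by
    rw [dEps, map_sum, Fintype.sum_prod_type]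
    refine Finset.sum_congr rfl fun j _ => ?_
    by_cases hj : β j = 0
    · simp [hj]
    · have hs := sum_dec Finset.univ hj (Finset.mem_univ j)
      simp only [hj, if_false, map_smul, false_or]
      rw [dK_eps q m _ (by omega), dEps, Finset.smul_sum]
      refine Finset.sum_congr rfl fun l _ => ?_
      split_ifs with hl
      · simp
      · rw [mul_smul]
  rw [key]
  refine Finset.sum_involution (fun p _ => p.swap) ?_ ?_ (fun _ _ => Finset.mem_univ _)
    (fun p _ => p.swap_swap)
  · rintro ⟨j, l⟩ -
    dsimp only [Prod.swap]
    by_cases hjl : l = j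
    · subst hjl
      split_ifs with h0
      · simp
      · rw [cof_mul_self q (fun h => h0 (Or.inl h))]; simp
    · simp only [dec_ne hjl, dec_ne (Ne.symm hjl)]
      by_cases h0 : β j = 0 ∨ β l = 0
      · rw [if_pos h0, if_pos h0.symm, add_zero]
      · rw [if_neg h0, if_neg (fun h => h0 h.symm), dec_comm β hjl, ← add_smul,
          cof_mul q hjl (fun h => h0 (Or.inl h)) (fun h => h0 (Or.inr h)), zero_smul]
  · rintro ⟨j, l⟩ - hne heq
    have hjl : l = j := congrArg Prod.fst heq
    subst hjl
    refine hne ?_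
    split_ifs with h0
    · rfl
    · rw [cof_mul_self q (fun h => h0 (Or.inl h)), zero_smul]

/-- The complex `K` of free `Λ_q`-bimodules. -/
def K : ChainComplex (ModuleCat.{u} (Env k (QCI q))) ℕ :=
  ChainComplex.of (fun m => ModuleCat.of (Env k (QCI q)) (KX q m))
    (fun m => ModuleCat.ofHom (dK q m)) (fun m => by
      rw [← ModuleCat.ofHom_comp]
      refine ModuleCat.hom_ext (Finsupp.lhom_ext' fun β => LinearMap.ext_ring ?_)
      change dK q m (dK q (m + 1) (Finsupp.single β 1)) = 0
      rw [dK.eq_1 q (m + 1), Finsupp.linearCombination_single, one_smul]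
      exact dK_dEps q m β.1 β.2)

lemma K_d (m : ℕ) : (K q).d (m + 1) m = ModuleCat.ofHom (dK q m) :=
  ChainComplex.of_d (fun m => ModuleCat.of (Env k (QCI q)) (KX q m))
    (fun m => ModuleCat.ofHom (dK q m)) m

/-- The augmentation `K_0 → Λ_q`, `ε_0 ↦ 1`. -/
def aug : KX q 0 →ₗ[Env k (QCI q)] selfBimod k (QCI q) :=
  Finsupp.linearCombination (Env k (QCI q)) fun _ : MIdx n 0 =>
    selfElt k (1 : QCI q)

lemma aug_dEps (β : Fin n → ℕ) (h : ∑ i, β i = 1) : aug q (dEps q 0 β) = 0 := by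
  rw [dEps, map_sum]
  refine Finset.sum_eq_zero fun j _ => ?_
  split_ifs with hj
  · exact map_zero _
  · have hs := sum_dec Finset.univ hj (Finset.mem_univ j)
    have h0 : ∀ i, dec β j i = 0 := by
      have : ∑ i, dec β j i = 0 := by omega
      simpa using this
    have hne : ∀ i, i ≠ j → β i = 0 := fun i hi => by rw [← dec_ne (β := β) hi, h0]
    have hjj : β j = 1 := by rw [dec_self β hj, h0]
    have hL : cL q β j = 1 :=
      Finset.prod_eq_one fun i hi => by rw [hne i (Finset.mem_Iio.1 hi).ne, pow_zero]
    have hR : cR q β j = -1 := by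
      rw [cR, sum_dec (Finset.Iic j) hj (Finset.mem_Iic.2 le_rfl),
        Finset.sum_eq_zero fun i _ => h0 i,
        Finset.prod_eq_one fun i hi => by rw [hne i (Finset.mem_Ioi.1 hi).ne', pow_zero]]
      simp
    rw [map_smul, eps, dif_pos (by simp [h0]), aug, Finsupp.linearCombination_single, one_smul,
      cof, hL, hR, one_smul, ← TensorProduct.tmul_smul, add_smul, smul_selfElt, smul_selfElt]
    change x q j * 1 * 1 + 1 * 1 * ((-1 : k) • x q j) = 0
    simp

/-- The augmentation as a map of complexes from `K` to `Λ_q` in degree zero. -/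
def Kπ : K q ⟶ (ChainComplex.single₀ (ModuleCat.{u} (Env k (QCI q)))).obj (selfBimod k (QCI q)) :=
  (ChainComplex.toSingle₀Equiv (K q) (selfBimod k (QCI q))).symm
    ⟨ModuleCat.ofHom (X := KX q 0) (Y := selfBimod k (QCI q)) (aug q), by
      rw [K_d q 0]
      refine ModuleCat.hom_ext (Finsupp.lhom_ext' fun β => LinearMap.ext_ring ?_)
      change aug q (dK q 0 (Finsupp.single β 1)) = 0
      rw [dK, Finsupp.linearCombination_single, one_smul]
      exact aug_dEps q β.1 β.2⟩

lemma K_projective (m : ℕ) : Projective ((K q).X m) :=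
  (IsProjective.iff_projective (R := Env k (QCI q)) (KX q m)).1 inferInstance

/-- Once the augmentation is a quasi-isomorphism, `K` is a projective resolution of `Λ_q`. -/
def Kres (h : QuasiIso (Kπ q)) : ProjectiveResolution (selfBimod k (QCI q)) where
  complex := K q
  projective := K_projective q
  π := Kπ q
  quasiIso := h

/-- The set `C_g`, where `c l` stands for `χ_{g,l}`: all `γ ∈ (ℕ ∪ {-1})^n` such that for each `l`
either `γ_l = -1` or `(-1)^{γ_l} ∏_{i ≠ l} (-q_{i,l})^{γ_i} = χ_{g,l}`. -/
def C (c : Fin n → k) : Set (Fin n → ℤ) :=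
  {γ | (∀ l, -1 ≤ γ l) ∧
    ∀ l, γ l = -1 ∨ (-1 : k) ^ γ l * ∏ i ∈ Finset.univ.erase l, (-q.val i l) ^ γ i = c l}

/-- The pairs `(α, β)` with `α ∈ {0,1}^n`, `β ∈ ℕ^n`, `|β| = m` and `β - α ∈ C_g`. -/
abbrev BIdx (c : Fin n → k) (m : ℕ) : Type :=
  {p : (Fin n → Fin 2) × MIdx n m // (fun i => (p.2.1 i : ℤ) - ((p.1 i : ℕ) : ℤ)) ∈ C q c}

variable {G : Type u} [Group G] [MulSemiringAction G (QCI q)] [SMulCommClass G k (QCI q)]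

/-- The cochain `(x^α ⊗ g) ε_β^* : K_m → Λ_q ⊗ g`, which maps `ε_β` to `x^α ⊗ g` and all other
`ε_{β'}` to zero. -/
def cochain (g : G) {m : ℕ} (α : Fin n → Fin 2) (β : MIdx n m) :
    (K q).X m ⟶ twistBimod k (QCI q) g :=
  ModuleCat.ofHom (X := KX q m) (Y := twistBimod k (QCI q) g)
    (Finsupp.linearCombination (Env k (QCI q)) fun β' : MIdx n m =>
      if β' = β then twistElt k (QCI q) g (mono q α) else 0)

end QCI
end Quantum

end HHQuantum
end

open HHQuantum

/-! ### The monomial basis of Λ. -/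

noncomputable section
namespace HHQuantum
namespace QCI

/-! Three arguments, largely independent of one another, are combined.

Exactness of `K`. The complex behaves like a twisted tensor product of the resolutions of k[x]/(x²)
in the n variables. For each j there is a k-linear homotopy that trades a left factor x_j for an
extra unit of β_j. The identity minus the boundary of this homotopy maps into elements with neither
x_j on the left nor j in β, and it does not spoil what was achieved for other variables. After all
variables only 1 ⊗ Λ at ε_0 survives, and the augmentation is injective there (`dK_exact`,
`aug_exact`).

Coefficients Λ ⊗ g. Since the monomials form a basis, Hom(K, Λ ⊗ g) has the cochains (x^α ⊗ g)ε_β^*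
as a basis, and its differential preserves γ = β - α. In a fixed multidegree, γ_j = -1 forces α_j =
1 and β_j = 0, while for every other j the exponent α_j is free. So the part of degree γ is a cube
of copies of k whose differential in direction j is a scalar `weight` depending only on γ, up to
sign. If some such scalar is nonzero the cube is contractible (`cubeD_cubeH`); if all vanish, so
does the differential, and every cochain counts (`cubeD_eq_zero`). The vanishing of the scalars is
exactly the condition defining C_g (`weight_eq_zero_iff`, `mem_C_iff`).

Passage to Λ ⋊ G. As a bimodule over Λ, the skew group algebra is the direct sum of the Λ ⊗ g. That
restriction is injective with the invariants as image holds for any algebra A and any bimodule M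
over A ⋊ G: in degree 0 a bimodule map out of A ⋊ G is an A-central element fixed by conjugation.
Higher degrees follow by dimension shifting along an embedding of M in a bimodule that is injective
over A ⋊ G and also over A (`exists_injective_embedding`). Averaging over G, possible in
characteristic 0, makes the invariants exact (`ResInvariants.succ`). -/

lemma mul_prod_ofFn {k R : Type*} [CommRing k] [Ring R] [Algebra k R] {m : ℕ} (f : Fin m → R)
    (y : R) (κ : Fin m → k) (i : Fin m) (h : ∀ l < i, y * f l = κ l • (f l * y)) :
    y * (List.ofFn f).prod =
      (∏ l, if l < i then κ l else 1) • (List.ofFn (Function.update f i (y * f i))).prod := by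
  induction m with
  | zero => exact i.elim0
  | succ m ih =>
    simp only [List.ofFn_succ, List.prod_cons, Fin.prod_univ_succ]
    refine Fin.cases ?_ (fun i h => ?_) i h
    · simp [mul_assoc]
    · have h0 := h 0 (Fin.succ_pos i)
      have hu : (fun l : Fin m => Function.update f i.succ (y * f i.succ) l.succ) =
          Function.update (fun l : Fin m => f l.succ) i (y * f i.succ) :=
        funext fun l => by simp [Function.update_apply]
      rw [← mul_assoc, h0, smul_mul_assoc, mul_assoc,
        ih (fun l => f l.succ) (fun l => κ l.succ) i fun l hl => h _ (Fin.succ_lt_succ_iff.2 hl), hu]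
      simp [Fin.succ_pos, Fin.succ_lt_succ_iff, smul_smul, (Fin.succ_ne_zero _).symm]

/-- Mirror image of `mul_prod_ofFn`: here `y` travels leftwards from the end, so the induction peels
off the last factor instead of the first. -/
lemma prod_ofFn_mul {k R : Type*} [CommRing k] [Ring R] [Algebra k R] {m : ℕ} (f : Fin m → R)
    (y : R) (κ : Fin m → k) (i : Fin m) (h : ∀ l, i < l → f l * y = κ l • (y * f l)) :
    (List.ofFn f).prod * y =
      (∏ l, if i < l then κ l else 1) • (List.ofFn (Function.update f i (f i * y))).prod := by
  induction m with
  | zero => exact i.elim0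
  | succ m ih =>
    rw [List.ofFn_succ', List.ofFn_succ', List.concat_eq_append, List.concat_eq_append]
    simp only [List.prod_append, List.prod_singleton, Fin.prod_univ_castSucc]
    refine Fin.lastCases ?_ (fun i h => ?_) i h
    · have hu : (fun l : Fin m => Function.update f (Fin.last m) (f (Fin.last m) * y) l.castSucc) =
          (fun l : Fin m => f l.castSucc) :=
        funext fun l => by simp [(Fin.castSucc_lt_last l).ne]
      rw [hu]
      simp [mul_assoc, Fin.not_lt.2 (Fin.le_last _)]
    · have h0 := h (Fin.last m) (Fin.castSucc_lt_last i)
      have hu : (fun l : Fin m => Function.update f i.castSucc (f i.castSucc * y) l.castSucc) =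
          Function.update (fun l : Fin m => f l.castSucc) i (f i.castSucc * y) :=
        funext fun l => by simp [Function.update_apply]
      rw [mul_assoc, h0, mul_smul_comm, ← mul_assoc,
        ih (fun l => f l.castSucc) (fun l => κ l.castSucc) i
          fun l hl => h _ (Fin.castSucc_lt_castSucc_iff.2 hl), hu]
      simp [Fin.castSucc_lt_last, Fin.castSucc_lt_castSucc_iff, smul_smul,
        (Fin.castSucc_lt_last i).ne', mul_comm]

variable {k : Type u} [Field k] {n : ℕ} (q : QCoeff k n)

lemma val_mul_val (i j : Fin n) : q.val i j * q.val j i = 1 := by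
  rw [q.symm i j, mul_inv_cancel₀ (q.ne_zero i j)]

lemma neg_val_ne_zero (i j : Fin n) : -q.val i j ≠ 0 := neg_ne_zero.2 (q.ne_zero i j)

/-- The presentation gives this for i < j only. The symmetry of q extends it to i > j, and for i = j
both sides vanish. -/
lemma x_mul_x_comm (i j : Fin n) : x q i * x q j = (-q.val i j) • (x q j * x q i) := by
  rcases lt_trichotomy i j with h | rfl | h
  · rw [x_mul_x q h, neg_smul]
  · rw [x_mul_self, smul_zero]
  · rw [x_mul_x q h, neg_smul, smul_neg, neg_neg, smul_smul, val_mul_val, one_smul]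

lemma x_mul_x_pow (i j : Fin n) (a : Fin 2) :
    x q i * x q j ^ (a : ℕ) = (-q.val i j) ^ (a : ℕ) • (x q j ^ (a : ℕ) * x q i) := by
  fin_cases a
  · simp
  · simpa using x_mul_x_comm q i j

lemma x_pow_mul_x (i j : Fin n) (a : Fin 2) :
    x q i ^ (a : ℕ) * x q j = (-q.val i j) ^ (a : ℕ) • (x q j * x q i ^ (a : ℕ)) := by
  fin_cases a
  · simp
  · simpa using x_mul_x_comm q i j

/-- `α + [j]` for `α_j = 0`. -/
def up (α : Fin n → Fin 2) (j : Fin n) : Fin n → Fin 2 := Function.update α j 1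

/-- `α - [j]` for `α_j = 1`. -/
def dn (α : Fin n → Fin 2) (j : Fin n) : Fin n → Fin 2 := Function.update α j 0

@[simp] lemma up_self (α : Fin n → Fin 2) (j : Fin n) : up α j j = 1 := by simp [up]

@[simp] lemma dn_self (α : Fin n → Fin 2) (j : Fin n) : dn α j j = 0 := by simp [dn]

lemma up_ne (α : Fin n → Fin 2) {i j : Fin n} (h : i ≠ j) : up α j i = α i := by simp [up, h]

lemma dn_ne (α : Fin n → Fin 2) {i j : Fin n} (h : i ≠ j) : dn α j i = α i := by simp [dn, h]

lemma dn_up {α : Fin n → Fin 2} {j : Fin n} (h : α j = 0) : dn (up α j) j = α := by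
  simp [dn, up, ← h]

lemma up_dn {α : Fin n → Fin 2} {j : Fin n} (h : α j = 1) : up (dn α j) j = α := by
  simp [dn, up, ← h]

lemma up_comm (α : Fin n → Fin 2) {i j : Fin n} (h : i ≠ j) :
    up (up α i) j = up (up α j) i := Function.update_comm h _ _ _

lemma dn_up_comm (α : Fin n → Fin 2) {i j : Fin n} (h : i ≠ j) :
    dn (up α i) j = up (dn α j) i := Function.update_comm h _ _ _

lemma eq_zero_or_one (a : Fin 2) : a = 0 ∨ a = 1 := by omega

/-- Induction on the number of exponents equal to 1, which may be added in any order. -/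
lemma exponent_induction {P : (Fin n → Fin 2) → Prop} (h0 : P 0)
    (h : ∀ α j, α j = 0 → P α → P (up α j)) (α : Fin n → Fin 2) : P α := by
  induction hs : (Finset.univ.filter fun l => α l = 1).card generalizing α with
  | zero =>
    have : α = 0 := funext fun l => by
      rcases eq_zero_or_one (α l) with h | h
      · exact h
      · have := Finset.filter_eq_empty_iff.1 (Finset.card_eq_zero.1 hs) (Finset.mem_univ l)
        exact absurd h this
    exact this ▸ h0
  | succ s ih =>
    obtain ⟨j, hj⟩ : (Finset.univ.filter fun l => α l = 1).Nonempty :=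
      Finset.card_pos.1 (by omega)
    have hj1 : α j = 1 := (Finset.mem_filter.1 hj).2
    rw [← up_dn hj1]
    refine h _ j (dn_self α j) (ih _ ?_)
    have : (Finset.univ.filter fun l => dn α j l = 1) =
        (Finset.univ.filter fun l => α l = 1).erase j := by
      ext l
      by_cases hl : l = j
      · subst hl; simp
      · simp [hl, dn_ne α hl]
    rw [this, Finset.card_erase_of_mem hj, hs, Nat.add_sub_cancel]

/-- The coefficient in `x_j x^α = ± x^{α+[j]}`. -/
def mulL (j : Fin n) (α : Fin n → Fin 2) : k :=
  ∏ l ∈ Finset.Iio j, (-q.val j l) ^ (α l : ℕ)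

/-- The coefficient in `x^α x_j = ± x^{α+[j]}`. -/
def mulR (j : Fin n) (α : Fin n → Fin 2) : k :=
  ∏ l ∈ Finset.Ioi j, (-q.val l j) ^ (α l : ℕ)

lemma mulL_ne_zero (j : Fin n) (α : Fin n → Fin 2) : mulL q j α ≠ 0 :=
  Finset.prod_ne_zero_iff.2 fun _ _ => pow_ne_zero _ (neg_val_ne_zero q _ _)

lemma mulR_ne_zero (j : Fin n) (α : Fin n → Fin 2) : mulR q j α ≠ 0 :=
  Finset.prod_ne_zero_iff.2 fun _ _ => pow_ne_zero _ (neg_val_ne_zero q _ _)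

lemma prod_up_of_notMem (f : Fin n → k) {s : Finset (Fin n)} {i : Fin n} (hi : i ∉ s)
    (α : Fin n → Fin 2) : ∏ l ∈ s, f l ^ (up α i l : ℕ) = ∏ l ∈ s, f l ^ (α l : ℕ) :=
  Finset.prod_congr rfl fun l hl => by rw [up_ne α (ne_of_mem_of_not_mem hl hi)]

lemma prod_up_of_mem (f : Fin n → k) {s : Finset (Fin n)} {i : Fin n} (hi : i ∈ s)
    {α : Fin n → Fin 2} (h : α i = 0) :
    ∏ l ∈ s, f l ^ (up α i l : ℕ) = f i * ∏ l ∈ s, f l ^ (α l : ℕ) := by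
  rw [← Finset.mul_prod_erase _ _ hi, ← Finset.mul_prod_erase s (fun l => f l ^ (α l : ℕ)) hi,
    prod_up_of_notMem f (Finset.notMem_erase i s)]
  simp [h]

lemma mulL_up_of_le {i j : Fin n} (h : j ≤ i) (α : Fin n → Fin 2) :
    mulL q j (up α i) = mulL q j α :=
  prod_up_of_notMem _ (by simpa using h) α

lemma mulL_up_of_lt {i j : Fin n} (h : i < j) {α : Fin n → Fin 2} (hi : α i = 0) :
    mulL q j (up α i) = -q.val j i * mulL q j α :=
  prod_up_of_mem (fun l => -q.val j l) (by simpa using h) hi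

lemma mulR_up_of_le {i j : Fin n} (h : i ≤ j) (α : Fin n → Fin 2) :
    mulR q j (up α i) = mulR q j α :=
  prod_up_of_notMem _ (by simpa using h) α

lemma mulR_up_of_lt {i j : Fin n} (h : j < i) {α : Fin n → Fin 2} (hi : α i = 0) :
    mulR q j (up α i) = -q.val i j * mulR q j α :=
  prod_up_of_mem (fun l => -q.val l j) (by simpa using h) hi

/-- The trace on coefficients of the commutation of x_i and x_j; it is what makes `mulOp` respect
the relations of Λ. -/
lemma mulL_mul_mulL {i j : Fin n} (h : i ≠ j) {α : Fin n → Fin 2} (hi : α i = 0) (hj : α j = 0) :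
    mulL q i (up α j) * mulL q j α = -q.val i j * (mulL q j (up α i) * mulL q i α) := by
  rcases lt_or_gt_of_ne h with h | h
  · rw [mulL_up_of_le q h.le, mulL_up_of_lt q h hi]
    linear_combination (-(mulL q i α * mulL q j α)) * val_mul_val q i j
  · rw [mulL_up_of_le q h.le, mulL_up_of_lt q h hj]
    ring

lemma mulR_mul_mulR {i j : Fin n} (h : i ≠ j) {α : Fin n → Fin 2} (hi : α i = 0) (hj : α j = 0) :
    mulR q i α * mulR q j (up α i) = -q.val i j * (mulR q j α * mulR q i (up α j)) := by
  rcases lt_or_gt_of_ne h with h | h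
  · rw [mulR_up_of_le q h.le, mulR_up_of_lt q h hj]
    linear_combination (-(mulR q i α * mulR q j α)) * val_mul_val q i j
  · rw [mulR_up_of_le q h.le, mulR_up_of_lt q h hi]
    ring

lemma ofFn_up (α : Fin n → Fin 2) (j : Fin n) :
    Function.update (fun l => x q l ^ (α l : ℕ)) j (x q j) = fun l => x q l ^ (up α j l : ℕ) := by
  funext l
  by_cases h : l = j
  · subst h; simp
  · simp [h, up_ne α h]

lemma ofFn_update_zero {f : Fin n → QCI q} (j : Fin n) :
    (List.ofFn (Function.update f j 0)).prod = 0 :=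
  List.prod_eq_zero (by rw [List.mem_ofFn]; exact ⟨j, by simp⟩)

lemma x_mul_mono (j : Fin n) (α : Fin n → Fin 2) :
    x q j * mono q α = if α j = 0 then mulL q j α • mono q (up α j) else 0 := by
  rw [mono, mul_prod_ofFn (fun l => x q l ^ (α l : ℕ)) (x q j)
    (fun l => (-q.val j l) ^ (α l : ℕ)) j fun l _ => x_mul_x_pow q j l (α l)]
  split_ifs with h
  · simp only [h, Fin.val_zero, pow_zero, mul_one]
    rw [ofFn_up, ← Finset.prod_filter, Finset.filter_gt_eq_Iio]
    rfl
  · simp only [(eq_zero_or_one (α j)).resolve_left h, Fin.val_one, pow_one, x_mul_self]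
    rw [ofFn_update_zero, smul_zero]

lemma mono_mul_x (j : Fin n) (α : Fin n → Fin 2) :
    mono q α * x q j = if α j = 0 then mulR q j α • mono q (up α j) else 0 := by
  rw [mono, prod_ofFn_mul (fun l => x q l ^ (α l : ℕ)) (x q j)
    (fun l => (-q.val l j) ^ (α l : ℕ)) j fun l _ => x_pow_mul_x q l j (α l)]
  split_ifs with h
  · simp only [h, Fin.val_zero, pow_zero, one_mul]
    rw [ofFn_up, ← Finset.prod_filter, Finset.filter_lt_eq_Ioi]
    rfl
  · simp only [(eq_zero_or_one (α j)).resolve_left h, Fin.val_one, pow_one, x_mul_self]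
    rw [ofFn_update_zero, smul_zero]

@[simp] lemma mono_zero : mono q 0 = 1 := by
  simp [mono]

/-- Left multiplication by `x_j` on formal combinations of monomials. -/
def mulOp (j : Fin n) : ((Fin n → Fin 2) →₀ k) →ₗ[k] ((Fin n → Fin 2) →₀ k) :=
  Finsupp.linearCombination k fun α =>
    if α j = 0 then Finsupp.single (up α j) (mulL q j α) else 0

lemma mulOp_single (j : Fin n) (α : Fin n → Fin 2) (c : k) :
    mulOp q j (Finsupp.single α c) =
      if α j = 0 then Finsupp.single (up α j) (c * mulL q j α) else 0 := by
  rw [mulOp, Finsupp.linearCombination_single]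
  split_ifs <;> simp

lemma mulOp_mul_self (i : Fin n) : mulOp q i * mulOp q i = 0 := by
  refine Finsupp.lhom_ext fun α c => ?_
  rw [Module.End.mul_apply, mulOp_single]
  split_ifs
  · rw [mulOp_single]; simp
  · simp

lemma mulOp_mul_comm {i j : Fin n} (h : i ≠ j) :
    mulOp q i * mulOp q j = -(q.val i j • (mulOp q j * mulOp q i)) := by
  refine Finsupp.lhom_ext fun α c => ?_
  simp only [LinearMap.neg_apply, LinearMap.smul_apply, Module.End.mul_apply, mulOp_single]
  by_cases hi : α i = 0 <;> by_cases hj : α j = 0 <;>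
    simp only [hi, hj, if_true, if_false, mulOp_single, up_ne α h, up_ne α h.symm, map_zero,
      smul_zero, neg_zero]
  rw [up_comm α h, Finsupp.smul_single, ← Finsupp.single_neg]
  congr 1
  rw [mul_assoc, mul_comm (mulL q j α), mulL_mul_mulL q h hi hj, smul_eq_mul]
  ring

/-- The action of `Λ_q` on formal combinations of monomials. -/
def rep : QCI q →ₐ[k] Module.End k ((Fin n → Fin 2) →₀ k) :=
  RingQuot.liftAlgHom k ⟨FreeAlgebra.lift k (mulOp q), fun a b h => by
    induction h with
    | comm i j h => simpa using mulOp_mul_comm q h.ne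
    | sq i => simpa using mulOp_mul_self q i⟩

lemma rep_x (j : Fin n) : rep q (x q j) = mulOp q j := by
  rw [rep, x, mk]
  exact (RingQuot.liftAlgHom_mkAlgHom_apply k _ _ _).trans (FreeAlgebra.lift_ι_apply _ _)

/-- Since j may be inserted anywhere in the monomial, x_j x^α is only a multiple of x^{α+[j]}; the
scalar is nonzero and is cancelled. -/
lemma rep_mono (α : Fin n → Fin 2) :
    rep q (mono q α) (Finsupp.single 0 1) = Finsupp.single α 1 := by
  induction α using exponent_induction with
  | h0 => simp
  | h α j hj ih =>
    have h1 := x_mul_mono q j α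
    rw [if_pos hj] at h1
    have h2 : mulL q j α • rep q (mono q (up α j)) (Finsupp.single 0 1) =
        mulL q j α • Finsupp.single (up α j) 1 := by
      rw [← LinearMap.smul_apply, ← map_smul, ← h1, map_mul, Module.End.mul_apply, ih, rep_x,
        mulOp_single, if_pos hj]
      simp
    exact smul_right_injective _ (mulL_ne_zero q j α) h2

/-- Acting on the vector attached to the exponent 0 sends the monomials to distinct basis vectors,
so no relation can hold between them. -/
lemma linearIndependent_mono : LinearIndependent k (mono q) := by
  refine LinearIndependent.of_comp
    ((LinearMap.applyₗ (Finsupp.single 0 1)).comp (rep q).toLinearMap) ?_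
  have : ((LinearMap.applyₗ (Finsupp.single 0 1)).comp (rep q).toLinearMap) ∘ mono q =
      fun α => Finsupp.single α (1 : k) := funext fun α => rep_mono q α
  rw [this]
  exact Finsupp.basisSingleOne.linearIndependent

/-- The span contains 1 and is stable under left multiplication by each generator, hence by all of
Λ. -/
lemma span_mono : Submodule.span k (Set.range (mono q)) = ⊤ := by
  refine eq_top_iff.2 fun y _ => ?_
  set S := Submodule.span k (Set.range (mono q))
  have hx : ∀ j, ∀ z ∈ S, x q j * z ∈ S := fun j z hz => by
    induction hz using Submodule.span_induction with
    | mem z hz =>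
      obtain ⟨α, rfl⟩ := hz
      rw [x_mul_mono]
      split_ifs
      · exact S.smul_mem _ (Submodule.subset_span ⟨_, rfl⟩)
      · exact S.zero_mem
    | zero => simp
    | add a b _ _ ha hb => rw [mul_add]; exact S.add_mem ha hb
    | smul c a _ ha => rw [mul_smul_comm]; exact S.smul_mem _ ha
  have key : ∀ f : FreeAlgebra k (Fin n), ∀ z ∈ S, mk q f * z ∈ S := fun f => by
    induction f using FreeAlgebra.induction with
    | grade0 r =>
      intro z hz
      rw [AlgHom.commutes, ← Algebra.smul_def]
      exact S.smul_mem _ hz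
    | grade1 j => exact hx j
    | mul a b ha hb =>
      intro z hz
      rw [map_mul, mul_assoc]
      exact ha _ (hb _ hz)
    | add a b ha hb =>
      intro z hz
      rw [map_add, add_mul]
      exact S.add_mem (ha _ hz) (hb _ hz)
  obtain ⟨f, rfl⟩ := RingQuot.mkAlgHom_surjective k (QRel q) y
  have := key f 1 (Submodule.subset_span ⟨0, mono_zero q⟩)
  rwa [mul_one] at this

/-- The monomials `x^α` form a basis of `Λ_q`. -/
def monoBasis : Module.Basis (Fin n → Fin 2) k (QCI q) :=
  Module.Basis.mk (linearIndependent_mono q) (span_mono q).ge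

@[simp] lemma monoBasis_apply (α : Fin n → Fin 2) : monoBasis q α = mono q α := by
  rw [monoBasis, Module.Basis.mk_apply]

end QCI
end HHQuantum
end

/-! ### Exactness of the complex K. -/

noncomputable section
namespace HHQuantum
namespace QCI

variable {k : Type u} [Field k] {n : ℕ} (q : QCoeff k n)

/-- `β + [j]`. -/
def inc (β : Fin n → ℕ) (j : Fin n) : Fin n → ℕ := Function.update β j (β j + 1)

@[simp] lemma inc_self (β : Fin n → ℕ) (j : Fin n) : inc β j j = β j + 1 := by simp [inc]

lemma inc_ne (β : Fin n → ℕ) {i j : Fin n} (h : i ≠ j) : inc β j i = β i := by simp [inc, h]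

@[simp] lemma dec_inc (β : Fin n → ℕ) (j : Fin n) : dec (inc β j) j = β := by simp [dec, inc]

lemma inc_dec {β : Fin n → ℕ} {j : Fin n} (h : β j ≠ 0) : inc (dec β j) j = β := by
  have : β j - 1 + 1 = β j := by omega
  simp [dec, inc, this]

lemma inc_dec_comm (β : Fin n → ℕ) {j l : Fin n} (h : l ≠ j) :
    inc (dec β l) j = dec (inc β j) l := by
  rw [inc, dec_ne h.symm, dec, dec, inc_ne _ h, inc, Function.update_comm h]

lemma sum_inc (β : Fin n → ℕ) (j : Fin n) : ∑ i, inc β j i = ∑ i, β i + 1 := by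
  rw [sum_dec Finset.univ (β := inc β j) (l := j) (by simp) (Finset.mem_univ j), dec_inc]

lemma sum_dec_of_eq {β : Fin n → ℕ} {j : Fin n} (h : β j ≠ 0) {m : ℕ} (hm : ∑ i, β i = m + 1) :
    ∑ i, dec β j i = m := by
  have := sum_dec Finset.univ h (Finset.mem_univ j)
  omega

lemma cL_ne_zero (β : Fin n → ℕ) (j : Fin n) : cL q β j ≠ 0 :=
  Finset.prod_ne_zero_iff.2 fun _ _ => pow_ne_zero _ (q.ne_zero _ _)

lemma cL_inc_self (β : Fin n → ℕ) (j : Fin n) : cL q (inc β j) j = cL q β j := by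
  rw [← cL_of_le q (β := inc β j) le_rfl, dec_inc]

lemma cR_inc_self (β : Fin n → ℕ) (j : Fin n) : cR q (inc β j) j = -cR q β j := by
  rw [cR_of_le q (β := inc β j) (l := j) le_rfl (by simp), dec_inc]

/-- With `cR_mul_cL`, this is the exchange rule for coefficients by which the directions l ≠ j
cancel in dh + hd for the homotopy h of direction j. -/
lemma cL_mul_cL {β : Fin n → ℕ} {j l : Fin n} (h : l ≠ j) (hl : β l ≠ 0) :
    q.val l j * (cL q (inc β j) l * cL q (dec β l) j) = cL q β l * cL q β j := by
  rcases lt_or_gt_of_ne h with h | h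
  · rw [cL_of_lt q h hl, ← cL_of_le q (β := inc β j) h.le, dec_inc]
    ring
  · rw [cL_of_le q (le_of_lt h), cL_of_lt q (β := inc β j) h (by simp), dec_inc]
    linear_combination (cL q β l * cL q β j) * val_mul_val q l j

lemma cR_mul_cL {β : Fin n → ℕ} {j l : Fin n} (h : l ≠ j) (hl : β l ≠ 0) :
    cR q (inc β j) l * cL q (dec β l) j + cR q β l * cL q β j = 0 := by
  rcases lt_or_gt_of_ne h with h | h
  · rw [cL_of_lt q h hl, cR_of_lt q (β := inc β j) h (by simp), dec_inc]
    ring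
  · rw [cL_of_le q (le_of_lt h), cR_of_le q (β := inc β j) (le_of_lt h) (by simp), dec_inc]
    ring

/-- The element `x^a ε_β x^b` of `K_m`. -/
def elt (m : ℕ) (a : Fin n → Fin 2) (β : Fin n → ℕ) (b : Fin n → Fin 2) : KX q m :=
  (mono q a ⊗ₜ[k] MulOpposite.op (mono q b) : Env k (QCI q)) • eps q m β

lemma elt_eq_single {m : ℕ} (a : Fin n → Fin 2) (β : MIdx n m) (b : Fin n → Fin 2) :
    elt q m a β.1 b =
      Finsupp.single β (mono q a ⊗ₜ[k] MulOpposite.op (mono q b) : Env k (QCI q)) := by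
  rw [elt, eps, dif_pos β.2, Finsupp.smul_single, smul_eq_mul, mul_one]

lemma span_elt (m : ℕ) :
    Submodule.span k (Set.range fun t : (Fin n → Fin 2) × MIdx n m × (Fin n → Fin 2) =>
      elt q m t.1 t.2.1.1 t.2.2) = ⊤ := by
  set S := Submodule.span k (Set.range fun t : (Fin n → Fin 2) × MIdx n m × (Fin n → Fin 2) =>
      elt q m t.1 t.2.1.1 t.2.2)
  suffices h : ∀ z, z ∈ S from eq_top_iff.2 fun z _ => h z
  intro z
  induction z using Finsupp.induction_linear with
  | zero => exact S.zero_mem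
  | add f g hf hg => exact S.add_mem hf hg
  | single β t =>
    induction t using TensorProduct.induction_on with
    | zero => rw [Finsupp.single_zero]; exact S.zero_mem
    | add f g hf hg => rw [Finsupp.single_add]; exact S.add_mem hf hg
    | tmul y z =>
      have hy : y ∈ Submodule.span k (Set.range (mono q)) := span_mono q ▸ trivial
      induction hy using Submodule.span_induction with
      | zero => rw [TensorProduct.zero_tmul, Finsupp.single_zero]; exact S.zero_mem
      | add f g _ _ hf hg =>
        rw [TensorProduct.add_tmul, Finsupp.single_add]; exact S.add_mem hf hg
      | smul c f _ hf =>
        rw [← TensorProduct.smul_tmul', ← Finsupp.smul_single]; exact S.smul_mem c hf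
      | mem y hy =>
        obtain ⟨a, rfl⟩ := hy
        induction z using MulOpposite.rec' with
        | _ z =>
        have hz : z ∈ Submodule.span k (Set.range (mono q)) := span_mono q ▸ trivial
        induction hz using Submodule.span_induction with
        | zero =>
          rw [MulOpposite.op_zero, TensorProduct.tmul_zero, Finsupp.single_zero]
          exact S.zero_mem
        | add f g _ _ hf hg =>
          rw [MulOpposite.op_add, TensorProduct.tmul_add, Finsupp.single_add]
          exact S.add_mem hf hg
        | smul c f _ hf =>
          rw [MulOpposite.op_smul, TensorProduct.tmul_smul, ← Finsupp.smul_single]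
          exact S.smul_mem c hf
        | mem z hz =>
          obtain ⟨b, rfl⟩ := hz
          exact Submodule.subset_span ⟨(a, β, b), elt_eq_single q a β b⟩

/-- The part of the differential of `x^a ε_β x^b` that lowers `β_l`. -/
def dPart (m : ℕ) (l : Fin n) (a : Fin n → Fin 2) (β : Fin n → ℕ) (b : Fin n → Fin 2) : KX q m :=
  if β l = 0 then 0 else
    (if a l = 0 then (cL q β l * mulR q l a) • elt q m (up a l) (dec β l) b else 0) +
    (if b l = 0 then (cR q β l * mulL q l b) • elt q m a (dec β l) (up b l) else 0)

lemma dK_elt (m : ℕ) (a : Fin n → Fin 2) {β : Fin n → ℕ} (b : Fin n → Fin 2)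
    (h : ∑ i, β i = m + 1) : dK q m (elt q (m + 1) a β b) = ∑ l, dPart q m l a β b := by
  rw [elt, map_smul, dK_eps q m β h, dEps, Finset.smul_sum]
  refine Finset.sum_congr rfl fun l _ => ?_
  rw [dPart]
  by_cases hl : β l = 0
  · simp [hl]
  rw [if_neg hl, if_neg hl, smul_smul, cof, mul_add, mul_smul_comm, mul_smul_comm,
    Algebra.TensorProduct.tmul_mul_tmul, Algebra.TensorProduct.tmul_mul_tmul, mul_one, mul_one,
    ← MulOpposite.op_mul, mono_mul_x, x_mul_mono, add_smul]
  congr 1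
  · split_ifs
    · rw [← TensorProduct.smul_tmul', smul_smul, smul_assoc, elt]
    · simp
  · split_ifs
    · rw [MulOpposite.op_smul, TensorProduct.tmul_smul, smul_smul, smul_assoc, elt]
    · simp

/-- The twisted right derivative of `Λ_q` with respect to `x_j`. -/
def deriv (j : Fin n) : QCI q →ₗ[k] QCI q :=
  (monoBasis q).constr k fun a =>
    if a j = 1 then (mulR q j (dn a j))⁻¹ • mono q (dn a j) else 0

lemma deriv_mono (j : Fin n) (a : Fin n → Fin 2) :
    deriv q j (mono q a) = if a j = 1 then (mulR q j (dn a j))⁻¹ • mono q (dn a j) else 0 := by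
  rw [← monoBasis_apply, deriv, Module.Basis.constr_basis]

/-- The homotopy in the direction of `x_j`. -/
def homotopy (j : Fin n) (m : ℕ) : KX q m →ₗ[k] KX q (m + 1) :=
  Finsupp.lsum k fun β : MIdx n m =>
    (Finsupp.lsingle (⟨inc β.1 j, by rw [sum_inc, β.2]⟩ : MIdx n (m + 1))).comp
      ((cL q β.1 j)⁻¹ • TensorProduct.map (deriv q j) LinearMap.id)

/-- The value of the homotopy on `x^a ε_β x^b`. -/
def hElt (m : ℕ) (j : Fin n) (a : Fin n → Fin 2) (β : Fin n → ℕ) (b : Fin n → Fin 2) : KX q m :=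
  if a j = 1 then (cL q β j * mulR q j (dn a j))⁻¹ • elt q m (dn a j) (inc β j) b else 0

lemma homotopy_elt (j : Fin n) {m : ℕ} (a : Fin n → Fin 2) {β : Fin n → ℕ} (b : Fin n → Fin 2)
    (h : ∑ i, β i = m) : homotopy q j m (elt q m a β b) = hElt q (m + 1) j a β b := by
  have h1 := elt_eq_single q a ⟨β, h⟩ b
  have h2 := elt_eq_single q (dn a j) (⟨inc β j, by rw [sum_inc, h]⟩ : MIdx n (m + 1)) b
  simp only at h1 h2
  rw [h1, homotopy, hElt, h2, Finsupp.lsum_single]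
  simp only [LinearMap.comp_apply, LinearMap.smul_apply, TensorProduct.map_tmul, deriv_mono,
    Finsupp.lsingle_apply, LinearMap.id_apply]
  split_ifs
  · rw [← TensorProduct.smul_tmul', smul_smul, mul_inv, Finsupp.smul_single]
  · simp

/-- The homotopy applied to `dPart`. -/
def hdPart (m : ℕ) (j l : Fin n) (a : Fin n → Fin 2) (β : Fin n → ℕ) (b : Fin n → Fin 2) :
    KX q m :=
  if β l = 0 then 0 else
    (if a l = 0 then (cL q β l * mulR q l a) • hElt q m j (up a l) (dec β l) b else 0) +
    (if b l = 0 then (cR q β l * mulL q l b) • hElt q m j a (dec β l) (up b l) else 0)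

/-- `dPart` applied to the homotopy. -/
def dhPart (m : ℕ) (j l : Fin n) (a : Fin n → Fin 2) (β : Fin n → ℕ) (b : Fin n → Fin 2) :
    KX q m :=
  if a j = 1 then (cL q β j * mulR q j (dn a j))⁻¹ • dPart q m l (dn a j) (inc β j) b else 0

lemma homotopy_dK_elt (j : Fin n) {m : ℕ} (a : Fin n → Fin 2) {β : Fin n → ℕ}
    (b : Fin n → Fin 2) (h : ∑ i, β i = m + 1) :
    homotopy q j m (dK q m (elt q (m + 1) a β b)) = ∑ l, hdPart q (m + 1) j l a β b := by
  rw [dK_elt q m a b h, map_sum]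
  refine Finset.sum_congr rfl fun l _ => ?_
  rw [dPart, hdPart]
  by_cases hl : β l = 0
  · simp [hl]
  · have hd := sum_dec_of_eq hl h
    rw [if_neg hl, if_neg hl, map_add]
    split_ifs <;> simp [homotopy_elt q j _ _ hd]

lemma dK_homotopy_elt (j : Fin n) {m : ℕ} (a : Fin n → Fin 2) {β : Fin n → ℕ}
    (b : Fin n → Fin 2) (h : ∑ i, β i = m) :
    dK q m (homotopy q j m (elt q m a β b)) = ∑ l, dhPart q m j l a β b := by
  rw [homotopy_elt q j a b h, hElt]
  simp only [dhPart]
  split_ifs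
  · rw [LinearMap.map_smul_of_tower, dK_elt q m _ _ (by rw [sum_inc, h]), Finset.smul_sum]
  · simp

lemma inv_mul_add_mul_inv {K : Type*} [Field K] {x x' y y' : K} (hy : y ≠ 0) (hy' : y' ≠ 0)
    (h : x * y' + x' * y = 0) : y⁻¹ * x + x' * y'⁻¹ = 0 := by
  field_simp
  linear_combination h

/-- The homotopy of direction j anticommutes with the part of the differential in any other
direction, so only direction j contributes to dh + hd. -/
lemma dhPart_add_hdPart_of_ne (m : ℕ) {j l : Fin n} (hl : l ≠ j) (a : Fin n → Fin 2)
    (β : Fin n → ℕ) (b : Fin n → Fin 2) :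
    dhPart q m j l a β b + hdPart q m j l a β b = 0 := by
  simp only [dhPart, hdPart, dPart, hElt, inc_ne β hl, dn_ne a hl, up_ne a hl.symm]
  by_cases hβ : β l = 0
  · simp [hβ]
  by_cases ha : a j = 1
  · have hc := mul_ne_zero (cL_ne_zero q β j) (mulR_ne_zero q j (dn a j))
    simp only [hβ, ha, if_true, if_false, smul_add, inc_dec_comm β hl, dn_up_comm a hl]
    -- Left terms: the exchange of x_l and x_j contributes -q_{l,j}, and the exchange of the `cL`
    -- coefficients absorbs q_{l,j}, leaving a sign.
    have h1 : a l = 0 → (cL q β j * mulR q j (dn a j))⁻¹ *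
          (cL q (inc β j) l * mulR q l (dn a j)) +
        (cL q β l * mulR q l a) * (cL q (dec β l) j * mulR q j (up (dn a j) l))⁻¹ = 0 := fun h0 => by
      refine inv_mul_add_mul_inv hc (mul_ne_zero (cL_ne_zero q _ _) (mulR_ne_zero q _ _)) ?_
      have e1 := mulR_mul_mulR q hl (α := dn a j) (by rw [dn_ne a hl, h0]) (dn_self a j)
      rw [up_dn ha] at e1
      linear_combination (cL q (inc β j) l * cL q (dec β l) j) * e1 -
        (mulR q j (dn a j) * mulR q l a) * cL_mul_cL q hl hβ
    -- Right terms: the homotopy does not touch the right factor, so the sign comes from the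
    -- coefficients `cR` and `cL` alone.
    have h2 : (cL q β j * mulR q j (dn a j))⁻¹ * (cR q (inc β j) l * mulL q l b) +
        (cR q β l * mulL q l b) * (cL q (dec β l) j * mulR q j (dn a j))⁻¹ = 0 := by
      refine inv_mul_add_mul_inv hc (mul_ne_zero (cL_ne_zero q _ _) (mulR_ne_zero q _ _)) ?_
      linear_combination (mulL q l b * mulR q j (dn a j)) * cR_mul_cL q hl hβ
    rw [add_add_add_comm]
    have h1' : ∀ h0 : a l = 0, _ := fun h0 => congrArg
      (fun t : k => t • elt q m (up (dn a j) l) (dec (inc β j) l) b) (h1 h0)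
    have h2' := congrArg (fun t : k => t • elt q m (dn a j) (dec (inc β j) l) (up b l)) h2
    simp only [add_smul, zero_smul, mul_smul] at h1' h2'
    by_cases h0 : a l = 0 <;> by_cases hb : b l = 0 <;>
      simp only [h0, hb, if_true, if_false, smul_zero, add_zero, zero_add, mul_smul]
    · rw [h1' h0, h2', add_zero]
    · exact h1' h0
    · exact h2'
  · simp [ha]

/-- The span of the `x^a ε_β x^b` with `a` and `β` vanishing on `T`. -/
def vanishing (m : ℕ) (T : Finset (Fin n)) : Submodule k (KX q m) :=
  Submodule.span k {z | ∃ a β b, ∑ i, β i = m ∧ (∀ l ∈ T, a l = 0 ∧ β l = 0) ∧ z = elt q m a β b}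

/-- If a_j = 0 and β_j = 0, nothing happens and the element already qualifies. If a_j = 0 and β_j >
0, then hd gives the element back. If a_j = 1, then dh gives it back together with a term where x_j
has moved to the right, which hd cancels when β_j > 0. -/
lemma sub_dhPart_sub_hdPart_mem (m : ℕ) (j : Fin n) (T : Finset (Fin n)) {a : Fin n → Fin 2}
    {β : Fin n → ℕ} (b : Fin n → Fin 2) (hm : ∑ i, β i = m)
    (hT : ∀ l ∈ T, a l = 0 ∧ β l = 0) :
    elt q m a β b - dhPart q m j j a β b - hdPart q m j j a β b ∈
      vanishing q m (insert j T) := by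
  have hc := mul_ne_zero (cL_ne_zero q β j) (mulR_ne_zero q j (dn a j))
  simp only [dhPart, hdPart, dPart, hElt, dec_inc, inc_self, dn_self, up_self, Nat.add_one_ne_zero,
    if_false, if_true, cL_inc_self, cR_inc_self]
  rcases eq_zero_or_one (a j) with ha | ha
  · by_cases hβ : β j = 0
    · simp only [ha, hβ, if_true, zero_ne_one, if_false, sub_zero]
      exact Submodule.subset_span ⟨a, β, b, hm, by simpa [ha, hβ] using hT, rfl⟩
    · have hc := mul_ne_zero (cL_ne_zero q β j) (mulR_ne_zero q j a)
      simp only [ha, hβ, if_true, zero_ne_one, if_false, sub_zero, smul_zero, ite_self, add_zero,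
        dn_up ha, cL_of_le q le_rfl, inc_dec hβ, smul_smul, mul_inv_cancel₀ hc, one_smul, sub_self]
      exact zero_mem _
  · simp only [ha, if_true, one_ne_zero, if_false, zero_add, up_dn ha, smul_add, smul_smul,
      inv_mul_cancel₀ hc, one_smul]
    by_cases hβ : β j = 0
    -- With β_j = 0 there is no hd term. What remains has lost its left factor x_j, so it vanishes
    -- in direction j.
    · simp only [hβ, if_true, sub_zero, sub_add_cancel_left]
      refine neg_mem ?_
      split_ifs
      · rw [smul_smul]
        refine Submodule.smul_mem _ _ (Submodule.subset_span ⟨dn a j, β, up b j, hm, ?_, rfl⟩)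
        intro l hl
        by_cases hlj : l = j
        · subst hlj; simp [hβ]
        · rw [dn_ne a hlj]
          exact hT l ((Finset.mem_insert.1 hl).resolve_left hlj)
      · simp
    -- The two terms with x_j on the right cancel because `cR` changes sign between β and β + [j].
    · simp only [hβ, if_false, cL_of_le q le_rfl, inc_dec hβ]
      convert (vanishing q m (insert j T)).zero_mem using 1
      split_ifs
      · module
      · simp

lemma elt_sub_mem (m : ℕ) (j : Fin n) (T : Finset (Fin n)) {a : Fin n → Fin 2}
    {β : Fin n → ℕ} (b : Fin n → Fin 2) (hm : ∑ i, β i = m)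
    (hT : ∀ l ∈ T, a l = 0 ∧ β l = 0) :
    elt q m a β b - ∑ l, dhPart q m j l a β b - ∑ l, hdPart q m j l a β b ∈
      vanishing q m (insert j T) := by
  have : ∑ l, dhPart q m j l a β b + ∑ l, hdPart q m j l a β b =
      dhPart q m j j a β b + hdPart q m j j a β b := by
    rw [← Finset.sum_add_distrib]
    exact Finset.sum_eq_single j (fun l _ hl => dhPart_add_hdPart_of_ne q m hl a β b)
      (fun h => absurd (Finset.mem_univ j) h)
  rw [sub_sub, this, ← sub_sub]
  exact sub_dhPart_sub_hdPart_mem q m j T b hm hT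

lemma sub_homotopy_mem_succ (m : ℕ) (j : Fin n) (T : Finset (Fin n)) {z : KX q (m + 1)}
    (hz : z ∈ vanishing q (m + 1) T) :
    z - dK q (m + 1) (homotopy q j (m + 1) z) - homotopy q j m (dK q m z) ∈
      vanishing q (m + 1) (insert j T) := by
  induction hz using Submodule.span_induction with
  | mem z hz =>
    obtain ⟨a, β, b, hm, hT, rfl⟩ := hz
    rw [dK_homotopy_elt q j a b hm, homotopy_dK_elt q j a b hm]
    exact elt_sub_mem q (m + 1) j T b hm hT
  | zero => simp
  | add y z _ _ hy hz =>
    convert add_mem hy hz using 1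
    simp only [map_add]
    abel
  | smul c z _ hz =>
    convert Submodule.smul_mem _ c hz using 1
    simp only [map_smul, LinearMap.map_smul_of_tower, smul_sub]

/-- In degree 0 every β_l is 0, so the hd term is absent. -/
lemma sub_homotopy_mem_zero (j : Fin n) (T : Finset (Fin n)) {z : KX q 0}
    (hz : z ∈ vanishing q 0 T) :
    z - dK q 0 (homotopy q j 0 z) ∈ vanishing q 0 (insert j T) := by
  induction hz using Submodule.span_induction with
  | mem z hz =>
    obtain ⟨a, β, b, hm, hT, rfl⟩ := hz
    have h0 : ∑ l, hdPart q 0 j l a β b = 0 := by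
      have : ∀ l, β l = 0 := by simpa using hm
      exact Finset.sum_eq_zero fun l _ => by simp [hdPart, this]
    have := elt_sub_mem q 0 j T b hm hT
    rwa [h0, sub_zero, ← dK_homotopy_elt q j a b hm] at this
  | zero => simp
  | add y z _ _ hy hz =>
    convert add_mem hy hz using 1
    simp only [map_add]
    abel
  | smul c z _ hz =>
    convert Submodule.smul_mem _ c hz using 1
    simp only [map_smul, LinearMap.map_smul_of_tower, smul_sub]

lemma vanishing_empty (m : ℕ) : vanishing q m ∅ = ⊤ := by
  refine eq_top_iff.2 ((span_elt q m).ge.trans (Submodule.span_mono ?_))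
  rintro _ ⟨t, rfl⟩
  exact ⟨t.1, t.2.1.1, t.2.2, t.2.1.2, by simp, rfl⟩

lemma vanishing_univ_succ (m : ℕ) : vanishing q (m + 1) Finset.univ = ⊥ := by
  refine Submodule.span_eq_bot.2 ?_
  rintro _ ⟨a, β, b, hm, hT, rfl⟩
  simp [fun l => (hT l (Finset.mem_univ l)).2] at hm

/-- Variables are eliminated one at a time. For a cycle the hd term is zero, so each elimination
changes it by a boundary and leaves a cycle. -/
lemma exists_vanishing_succ (m : ℕ) (T : Finset (Fin n)) (z : KX q (m + 1))
    (hz : dK q m z = 0) :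
    ∃ w ∈ vanishing q (m + 1) T, dK q m w = 0 ∧ ∃ y, z - w = dK q (m + 1) y := by
  induction T using Finset.induction_on with
  | empty => exact ⟨z, vanishing_empty q (m + 1) ▸ trivial, hz, 0, by simp⟩
  | insert j T _ ih =>
    obtain ⟨w, hw, hdw, y, hy⟩ := ih
    have h := sub_homotopy_mem_succ q m j T hw
    rw [hdw, map_zero, sub_zero] at h
    refine ⟨_, h, ?_, y + homotopy q j (m + 1) w, by rw [map_add, ← hy]; abel⟩
    rw [map_sub, hdw, zero_sub, neg_eq_zero]
    have hdd : dK q m ∘ₗ dK q (m + 1) = 0 := by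
      refine Finsupp.lhom_ext' fun β => LinearMap.ext_ring ?_
      change dK q m (dK q (m + 1) (Finsupp.single β 1)) = 0
      rw [dK.eq_1 q (m + 1), Finsupp.linearCombination_single, one_smul]
      exact dK_dEps q m β.1 β.2
    exact LinearMap.congr_fun hdd _

lemma dK_exact (m : ℕ) (z : KX q (m + 1)) (hz : dK q m z = 0) : ∃ y, dK q (m + 1) y = z := by
  obtain ⟨w, hw, -, y, hy⟩ := exists_vanishing_succ q m Finset.univ z hz
  rw [vanishing_univ_succ, Submodule.mem_bot] at hw
  exact ⟨y, by rw [← hy, hw, sub_zero]⟩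

lemma aug_single (β : MIdx n 0) (y z : QCI q) :
    aug q (Finsupp.single β (y ⊗ₜ[k] MulOpposite.op z)) = selfElt k (y * z) := by
  rw [aug, Finsupp.linearCombination_single, smul_selfElt]
  simp

lemma aug_dK (z : KX q 1) : aug q (dK q 0 z) = 0 := by
  have h : aug q ∘ₗ dK q 0 = 0 := by
    refine Finsupp.lhom_ext' fun β => LinearMap.ext_ring ?_
    change aug q (dK q 0 (Finsupp.single β 1)) = 0
    rw [dK, Finsupp.linearCombination_single, one_smul]
    exact aug_dEps q β.1 β.2
  exact LinearMap.congr_fun h z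

lemma exists_vanishing_zero (T : Finset (Fin n)) (z : KX q 0) :
    ∃ w ∈ vanishing q 0 T, ∃ y, z - w = dK q 0 y := by
  induction T using Finset.induction_on with
  | empty => exact ⟨z, vanishing_empty q 0 ▸ trivial, 0, by simp⟩
  | insert j T _ ih =>
    obtain ⟨w, hw, y, hy⟩ := ih
    exact ⟨_, sub_homotopy_mem_zero q j T hw, y + homotopy q j 0 w, by rw [map_add, ← hy]; abel⟩

/-- The index `β = 0`. -/
def idxZero (n : ℕ) : MIdx n 0 := ⟨0, by simp⟩

/-- Once all variables are eliminated on the left, only the right factor is free; the augmentation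
reads it off, which is how `aug_exact` concludes. -/
lemma vanishing_univ_zero {w : KX q 0} (hw : w ∈ vanishing q 0 Finset.univ) :
    ∃ y : QCI q, w = Finsupp.single (idxZero n) (1 ⊗ₜ[k] MulOpposite.op y) := by
  induction hw using Submodule.span_induction with
  | mem z hz =>
    obtain ⟨a, β, b, hm, hT, rfl⟩ := hz
    have ha : a = 0 := funext fun l => (hT l (Finset.mem_univ l)).1
    have hβ : β = (idxZero n).1 := funext fun l => (hT l (Finset.mem_univ l)).2
    exact ⟨mono q b, by rw [ha, hβ, elt_eq_single, mono_zero]⟩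
  | zero => exact ⟨0, by simp⟩
  | add y z _ _ hy hz =>
    obtain ⟨y, rfl⟩ := hy
    obtain ⟨z, rfl⟩ := hz
    exact ⟨y + z, by rw [MulOpposite.op_add, TensorProduct.tmul_add, Finsupp.single_add]⟩
  | smul c z _ hz =>
    obtain ⟨z, rfl⟩ := hz
    exact ⟨c • z, by rw [MulOpposite.op_smul, TensorProduct.tmul_smul, Finsupp.smul_single]⟩

lemma aug_exact (z : KX q 0) (hz : aug q z = 0) : ∃ y, dK q 0 y = z := by
  obtain ⟨w, hw, y, hy⟩ := exists_vanishing_zero q Finset.univ z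
  obtain ⟨t, rfl⟩ := vanishing_univ_zero q hw
  have h : aug q (z - Finsupp.single (idxZero n) (1 ⊗ₜ[k] MulOpposite.op t)) = 0 := by
    rw [hy, aug_dK]
  rw [map_sub, hz, aug_single, zero_sub, neg_eq_zero, one_mul] at h
  have ht : t = 0 := h
  exact ⟨y, by rw [← hy, ht]; simp⟩

lemma aug_surjective : Function.Surjective (aug q) := fun y =>
  ⟨Finsupp.single (idxZero n) ((show QCI q from y) ⊗ₜ[k] MulOpposite.op 1), by
    rw [aug_single, mul_one]; rfl⟩

end QCI
end HHQuantum
end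

/-! ### K as a projective resolution, and classes of cocycles in Ext. -/

noncomputable section
namespace HHQuantum
namespace QCI

variable {k : Type u} [Field k] {n : ℕ} (q : QCoeff k n)

lemma quasiIso_Kπ : QuasiIso (Kπ q) := ⟨fun m => by
  cases m with
  | zero =>
    rw [ChainComplex.quasiIsoAt₀_iff, ShortComplex.quasiIso_iff_of_zeros' _ rfl rfl rfl]
    have h0 : (Kπ q).f 0 = ModuleCat.ofHom (X := KX q 0) (Y := selfBimod k (QCI q)) (aug q) :=
      ChainComplex.toSingle₀Equiv_symm_apply_f_zero _ _
    constructor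
    · rw [ShortComplex.moduleCat_exact_iff]
      intro z hz
      obtain ⟨y, hy⟩ := aug_exact q z (by
        have : (Kπ q).f 0 z = 0 := hz
        rwa [h0] at this)
      refine ⟨y, ?_⟩
      change (K q).d 1 0 y = z
      rw [K_d q 0]
      exact hy
    · change Epi ((Kπ q).f 0)
      rw [h0]
      exact (ModuleCat.epi_iff_surjective
        (ModuleCat.ofHom (X := KX q 0) (Y := selfBimod k (QCI q)) (aug q))).2 (aug_surjective q)
  | succ m =>
    rw [quasiIsoAt_iff_exactAt']
    · rw [HomologicalComplex.exactAt_iff' _ (m + 2) (m + 1) m (by simp) (by simp),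
        ShortComplex.moduleCat_exact_iff]
      intro z hz
      have hz' : (K q).d (m + 1) m z = 0 := hz
      rw [K_d q m] at hz'
      obtain ⟨y, hy⟩ := dK_exact q m z hz'
      refine ⟨y, ?_⟩
      change (K q).d (m + 2) (m + 1) y = z
      rw [K_d q (m + 1)]
      exact hy
    · exact ChainComplex.exactAt_succ_single_obj _ _⟩

end QCI

section ExtMk

open Abelian Limits CochainComplex HomComplex

variable {C : Type*} [Category.{u} C] [Abelian C]

variable {k : Type*} [Field k] [Linear k C]

/-- The submodule of cocycles. -/
def cocycleSubmodule (L : ChainComplex C ℕ) (Y : C) (m : ℕ) : Submodule k (L.X m ⟶ Y) where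
  carrier := {f | L.d (m + 1) m ≫ f = 0}
  add_mem' {f g} (hf : _ = 0) (hg : _ = 0) := by
    change L.d (m + 1) m ≫ (f + g) = 0
    rw [Preadditive.comp_add, hf, hg, add_zero]
  zero_mem' := comp_zero
  smul_mem' c f (hf : _ = 0) := by
    change L.d (m + 1) m ≫ (c • f) = 0
    rw [Linear.comp_smul, hf, smul_zero]

lemma d_comp_cocycle {L : ChainComplex C ℕ} {Y : C} {m : ℕ}
    (f : cocycleSubmodule (k := k) L Y m) : L.d (m + 1) m ≫ f.1 = 0 := f.2

variable [HasExt.{u} C] {X Y : C} (R : ProjectiveResolution X)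

/-- A coboundary in degree 0 would factor through the term of the resolution in cochain degree 1,
which is zero. -/
lemma extMk_zero_eq_zero_iff (f : R.complex.X 0 ⟶ Y) (hf : R.complex.d 1 0 ≫ f = 0) :
    R.extMk f 1 rfl hf = 0 ↔ f = 0 := by
  refine ⟨fun h => ?_, fun h => by subst h; exact R.extMk_zero 1 rfl⟩
  rw [← R.extEquivCohomologyClass.apply_eq_iff_eq,
    ProjectiveResolution.extEquivCohomologyClass_extMk,
    ProjectiveResolution.extEquivCohomologyClass_zero, CohomologyClass.mk_eq_zero_iff,
    Cocycle.toSingleMk_mem_coboundaries_iff _ _ _ _ _ 1 (by simp)] at h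
  obtain ⟨g, hg⟩ := h
  have h1 : IsZero (R.cochainComplex.X 1) :=
    R.complex.isZero_extend_X ComplexShape.embeddingDownNat 1 fun i (hi : -(i : ℤ) = 1) => by
      omega
  rw [h1.eq_of_src g 0, comp_zero] at hg
  rw [← cancel_epi (R.cochainComplexXIso (-(0 : ℕ) : ℤ) 0 rfl).hom, ← hg, comp_zero]

/-- The class of a cocycle, as a linear map. -/
def extMkLinear (Y : C) (m : ℕ) : cocycleSubmodule (k := k) R.complex Y m →ₗ[k] Ext.{u} X Y m where
  toFun f := R.extMk f.1 (m + 1) rfl (d_comp_cocycle f)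
  map_add' f g :=
    (R.add_extMk f.1 g.1 (m + 1) rfl (d_comp_cocycle f) (d_comp_cocycle g)).symm
  map_smul' c f := by
    -- A scalar acts on Ext as postcomposition with its multiple of the identity, which can be
    -- carried out on the cocycle.
    rw [RingHom.id_apply, Ext.smul_eq_comp_mk₀, R.extMk_comp_mk₀]
    congr 1
    rw [Linear.comp_smul, Category.comp_id]
    rfl

end ExtMk
end HHQuantum
end

/-! ### Cube complexes in a fixed multidegree, and their weights. -/

noncomputable section
namespace HHQuantum
namespace QCI

section Cube

variable {k : Type*} [Field k] {n : ℕ}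

/-- The multidegree `β - α`. -/
def degree (α : Fin n → Fin 2) (β : Fin n → ℕ) : Fin n → ℤ := fun i => (β i : ℤ) - ((α i : ℕ) : ℤ)

lemma degree_dn_dec {α : Fin n → Fin 2} {β : Fin n → ℕ} {j : Fin n} (hα : α j = 1)
    (hβ : β j ≠ 0) : degree (dn α j) (dec β j) = degree α β := by
  funext i
  by_cases h : i = j
  · subst h
    simp only [degree, dn_self, hα, dec_self β hβ]
    push_cast
    simp
  · simp [degree, dn_ne α h, dec_ne h]

lemma degree_up_inc {α : Fin n → Fin 2} (β : Fin n → ℕ) {j : Fin n} (hα : α j = 0) :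
    degree (up α j) (inc β j) = degree α β := by
  have := degree_dn_dec (α := up α j) (β := inc β j) (j := j) (by simp) (by simp)
  rw [← this, dn_up hα, dec_inc]

/-- The sign `(-1)^{∑_{l<j} β_l}`. -/
def sgn (k : Type*) [Field k] (β : Fin n → ℕ) (j : Fin n) : k := (-1) ^ ∑ l ∈ Finset.Iio j, β l

lemma sgn_mul_self (β : Fin n → ℕ) (j : Fin n) : sgn k β j * sgn k β j = 1 := by
  rw [sgn, ← mul_pow]
  simp

lemma sgn_inc_of_le (β : Fin n → ℕ) {i j : Fin n} (h : j ≤ i) :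
    sgn k (inc β i) j = sgn k β j := by
  rw [sgn, sgn, Finset.sum_congr rfl fun l hl => inc_ne β ((Finset.mem_Iio.1 hl).trans_le h).ne]

lemma sgn_inc_of_lt (β : Fin n → ℕ) {i j : Fin n} (h : i < j) :
    sgn k (inc β i) j = -sgn k β j := by
  rw [sgn, sgn, sum_dec (Finset.Iio j) (β := inc β i) (l := i) (by simp) (by simpa using h),
    dec_inc, pow_succ, mul_neg_one]

lemma sgn_dec_of_le (β : Fin n → ℕ) {i j : Fin n} (h : j ≤ i) :
    sgn k (dec β i) j = sgn k β j := by
  rw [sgn, sgn, Finset.sum_congr rfl fun l hl => dec_ne ((Finset.mem_Iio.1 hl).trans_le h).ne]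

lemma sgn_dec_of_lt {β : Fin n → ℕ} {i j : Fin n} (h : i < j) (hi : β i ≠ 0) :
    sgn k (dec β i) j = -sgn k β j := by
  rw [← inc_dec hi, sgn_inc_of_lt _ h, neg_neg, dec_inc]

/-- The Koszul sign rule: lowering in direction j and raising in direction i anticommute. -/
lemma sgn_mul_sgn {β : Fin n → ℕ} {i j : Fin n} (h : j ≠ i) (hj : β j ≠ 0) :
    sgn k β j * sgn k (dec β j) i = -(sgn k (inc β i) j * sgn k β i) := by
  rcases lt_or_gt_of_ne h with h | h
  · rw [sgn_dec_of_lt h hj, sgn_inc_of_le β h.le]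
    ring
  · rw [sgn_dec_of_le β (le_of_lt h), sgn_inc_of_lt β h]
    ring

/-- The Koszul type coboundary with weights `c j γ` in multidegree `γ`. -/
def cubeD (c : Fin n → (Fin n → ℤ) → k) (F : (Fin n → Fin 2) → (Fin n → ℕ) → k)
    (α : Fin n → Fin 2) (β : Fin n → ℕ) : k :=
  ∑ j, if α j = 1 ∧ β j ≠ 0 then
    sgn k β j * c j (degree α β) * F (dn α j) (dec β j) else 0

open Classical in
/-- The contracting homotopy for `cubeD` in multidegree `γ`, for `γ` with a nonzero weight. -/
def cubeHAt (c : Fin n → (Fin n → ℤ) → k) (F : (Fin n → Fin 2) → (Fin n → ℕ) → k)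
    (γ : Fin n → ℤ) (α : Fin n → Fin 2) (β : Fin n → ℕ) : k :=
  if h : ∃ j, γ j ≠ -1 ∧ c j γ ≠ 0 then
    if α h.choose = 0 then
      sgn k β h.choose * (c h.choose γ)⁻¹ * F (up α h.choose) (inc β h.choose) else 0
  else 0

/-- The contracting homotopy for `cubeD` away from the multidegrees in which all weights vanish. -/
def cubeH (c : Fin n → (Fin n → ℤ) → k) (F : (Fin n → Fin 2) → (Fin n → ℕ) → k)
    (α : Fin n → Fin 2) (β : Fin n → ℕ) : k :=
  cubeHAt c F (degree α β) α β

/-- A direction of nonzero weight contracts the cube. `G` is prescribed only on the multidegree of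
(α, β), since `cubeD` at (α, β) looks at no other values. -/
lemma cubeD_cubeH_of_choose (c : Fin n → (Fin n → ℤ) → k)
    (F : (Fin n → Fin 2) → (Fin n → ℕ) → k)
    (hF : ∀ α β, cubeD c F α β = 0) {α : Fin n → Fin 2} {β : Fin n → ℕ} {i : Fin n}
    (hi : degree α β i ≠ -1) (hc : c i (degree α β) ≠ 0) (G : (Fin n → Fin 2) → (Fin n → ℕ) → k)
    (hG : ∀ α' β', degree α' β' = degree α β → G α' β' = if α' i = 0 then
      sgn k β' i * (c i (degree α β))⁻¹ * F (up α' i) (inc β' i) else 0) :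
    cubeD c G α β = F α β := by
  have hG' : ∀ j, α j = 1 → β j ≠ 0 → G (dn α j) (dec β j) = if (dn α j) i = 0 then
      sgn k (dec β j) i * (c i (degree α β))⁻¹ * F (up (dn α j) i) (inc (dec β j) i) else 0 :=
    fun j h1 h2 => hG _ _ (degree_dn_dec h1 h2)
  rcases eq_zero_or_one (α i) with h | h
  -- When α_i = 0, the cocycle equation one step up in direction i has the value of `F` at (α, β) as
  -- its i-th term; the other terms match those of the homotopy up to a common factor.
  · have hz := hF (up α i) (inc β i)
    rw [cubeD, ← Finset.add_sum_erase _ _ (Finset.mem_univ i), degree_up_inc β h, dn_up h,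
      dec_inc, if_pos (by simp), sgn_inc_of_le β le_rfl] at hz
    rw [cubeD, ← Finset.add_sum_erase _ _ (Finset.mem_univ i), if_neg (by simp [h]), zero_add]
    have key : ∀ j ∈ Finset.univ.erase i,
        (if α j = 1 ∧ β j ≠ 0 then
          sgn k β j * c j (degree α β) * G (dn α j) (dec β j) else 0) =
        -(sgn k β i * (c i (degree α β))⁻¹) *
        (if up α i j = 1 ∧ inc β i j ≠ 0 then
          sgn k (inc β i) j * c j (degree α β) * F (dn (up α i) j) (dec (inc β i) j) else 0) := by
      intro j hj
      have hj := Finset.ne_of_mem_erase hj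
      rw [up_ne α hj, inc_ne β hj]
      split_ifs with h1
      · rw [hG' j h1.1 h1.2, if_pos (by rw [dn_ne α hj.symm, h]), dn_up_comm α hj.symm,
          inc_dec_comm β hj]
        linear_combination ((c i (degree α β))⁻¹ * c j (degree α β) *
          F (up (dn α j) i) (dec (inc β i) j)) * sgn_mul_sgn (k := k) hj h1.2
      · simp
    rw [Finset.sum_congr rfl key, ← Finset.mul_sum, eq_neg_of_add_eq_zero_right hz]
    field_simp
    linear_combination F α β * sgn_mul_self (k := k) β i
  -- When α_i = 1, γ_i ≠ -1 gives β_i > 0. Only the summand j = i survives, since lowering another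
  -- direction keeps α_i = 1, where `G` is zero.
  · have hβ : β i ≠ 0 := fun h0 => hi (by simp [degree, h0, h])
    rw [cubeD, Finset.sum_eq_single i]
    · rw [if_pos ⟨h, hβ⟩, hG' i h hβ, if_pos (dn_self α i), up_dn h, inc_dec hβ,
        sgn_dec_of_le β le_rfl]
      field_simp
      linear_combination F α β * sgn_mul_self (k := k) β i
    · intro j _ hj
      split_ifs with h1
      · rw [hG' j h1.1 h1.2, if_neg (by simp [dn_ne α hj.symm, h]), mul_zero]
      · rfl
    · simp

lemma cubeD_cubeH (c : Fin n → (Fin n → ℤ) → k) (F : (Fin n → Fin 2) → (Fin n → ℕ) → k)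
    (hF : ∀ α β, cubeD c F α β = 0)
    (h0 : ∀ α β, (∀ j, degree α β j = -1 ∨ c j (degree α β) = 0) → F α β = 0)
    (α : Fin n → Fin 2) (β : Fin n → ℕ) : cubeD c (cubeH c F) α β = F α β := by
  by_cases h : ∃ j, degree α β j ≠ -1 ∧ c j (degree α β) ≠ 0
  -- The chosen direction depends on the multidegree alone, so it is the same at all entries of one
  -- cube.
  · refine cubeD_cubeH_of_choose c F hF h.choose_spec.1 h.choose_spec.2 _ fun α' β' hd => ?_
    rw [cubeH, hd, cubeHAt, dif_pos h]
  · rw [h0 α β fun j => by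
      by_contra hj
      exact h ⟨j, not_or.1 hj⟩]
    refine Finset.sum_eq_zero fun j _ => ?_
    split_ifs with h1
    · rw [cubeH, degree_dn_dec h1.1 h1.2, cubeHAt, dif_neg h, mul_zero]
    · rfl

lemma cubeH_of_sum_ne (c : Fin n → (Fin n → ℤ) → k) {F : (Fin n → Fin 2) → (Fin n → ℕ) → k}
    {m : ℕ} (hF : ∀ α β, ∑ i, β i ≠ m → F α β = 0) (α : Fin n → Fin 2) (β : Fin n → ℕ)
    (h : ∑ i, β i + 1 ≠ m) : cubeH c F α β = 0 := by
  rw [cubeH, cubeHAt]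
  split_ifs
  · rw [hF _ _ (by rwa [sum_inc]), mul_zero]
  · rfl
  · rfl

/-- A direction with γ_j = -1 contributes nothing: α_j = 1 then forces β_j = 0. All other directions
have weight 0. -/
lemma cubeD_eq_zero {c : Fin n → (Fin n → ℤ) → k} (F : (Fin n → Fin 2) → (Fin n → ℕ) → k)
    {α : Fin n → Fin 2} {β : Fin n → ℕ} (h : ∀ j, degree α β j = -1 ∨ c j (degree α β) = 0) :
    cubeD c F α β = 0 := by
  refine Finset.sum_eq_zero fun j _ => ?_
  split_ifs with h1
  · rcases h j with h2 | h2
    · have : degree α β j = (β j : ℤ) - 1 := by simp [degree, h1.1]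
      have := h1.2
      omega
    · rw [h2, mul_zero, zero_mul]
  · rfl

end Cube

section Coefficients

variable {k : Type u} [Field k] {n : ℕ} (q : QCoeff k n) (χ : Fin n → k)

/-- The weight of the direction `j` in multidegree `γ`. -/
def weight (j : Fin n) (γ : Fin n → ℤ) : k :=
  ∏ l ∈ Finset.Iio j, (-q.val l j) ^ γ l -
    χ j * ((-1) ^ γ j * ∏ l ∈ Finset.Ioi j, (-q.val j l) ^ γ l)

/-- The product over i ≠ j splits at j. The symmetry of q inverts the upper half, and the sign
(-1)^{γ_j} is its own inverse, so the condition rearranges to equality of the two terms of the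
weight. -/
lemma weight_eq_zero_iff (j : Fin n) (γ : Fin n → ℤ) :
    weight q χ j γ = 0 ↔
      (-1 : k) ^ γ j * ∏ i ∈ Finset.univ.erase j, (-q.val i j) ^ γ i = χ j := by
  have h1 : ∏ i ∈ Finset.univ.erase j, (-q.val i j) ^ γ i =
      (∏ l ∈ Finset.Iio j, (-q.val l j) ^ γ l) * ∏ l ∈ Finset.Ioi j, (-q.val l j) ^ γ l := by
    rw [← Finset.prod_union]
    · congr 1
      ext i
      simp [lt_or_lt_iff_ne]
    · exact Finset.disjoint_left.2 fun i hi hi' =>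
        lt_asymm (Finset.mem_Iio.1 hi) (Finset.mem_Ioi.1 hi')
  have h2 : ∏ l ∈ Finset.Ioi j, (-q.val l j) ^ γ l =
      (∏ l ∈ Finset.Ioi j, (-q.val j l) ^ γ l)⁻¹ := by
    rw [← Finset.prod_inv_distrib]
    refine Finset.prod_congr rfl fun l _ => ?_
    rw [q.symm j l, ← inv_zpow, inv_neg, ← inv_neg]
  have h3 : ∏ l ∈ Finset.Ioi j, (-q.val j l) ^ γ l ≠ 0 :=
    Finset.prod_ne_zero_iff.2 fun _ _ => zpow_ne_zero _ (neg_val_ne_zero q _ _)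
  have h4 : (-1 : k) ^ γ j * (-1 : k) ^ γ j = 1 := by
    rw [← mul_zpow]
    simp
  rw [h1, h2, weight, sub_eq_zero]
  constructor
  · intro h
    rw [h]
    field_simp
    linear_combination χ j * h4
  · intro h
    rw [← h]
    field_simp
    linear_combination (-(∏ l ∈ Finset.Iio j, (-q.val l j) ^ γ l)) * h4

/-- The bound γ_l ≥ -1 is automatic for a difference β - α. -/
lemma mem_C_iff (α : Fin n → Fin 2) (β : Fin n → ℕ) :
    degree α β ∈ C q χ ↔ ∀ j, degree α β j = -1 ∨ weight q χ j (degree α β) = 0 := by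
  simp only [weight_eq_zero_iff]
  refine ⟨fun h => h.2, fun h => ⟨fun l => ?_, h⟩⟩
  have := (α l).isLt
  simp only [degree]
  omega

lemma prod_neg_val_zpow_degree (s : Finset (Fin n)) (f : Fin n → k) (hf : ∀ l, f l ≠ 0)
    (α : Fin n → Fin 2) (β : Fin n → ℕ) :
    ∏ l ∈ s, f l ^ degree α β l = (∏ l ∈ s, f l ^ β l) * ∏ l ∈ s, (f l)⁻¹ ^ (α l : ℕ) := by
  rw [← Finset.prod_mul_distrib]
  refine Finset.prod_congr rfl fun l _ => ?_
  rw [degree, zpow_sub₀ (hf l), zpow_natCast, zpow_natCast, inv_pow, div_eq_mul_inv]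

/-- The exponents of β come from the resolution and those of α from multiplying monomials. The
symmetry of q turns the latter into negative powers, so only β - α is left. Replacing q by -q in
`cL` produces the sign `sgn`, and α_j = 1 accounts for the minus sign in `weight`. -/
lemma sgn_mul_weight {j : Fin n} {α : Fin n → Fin 2} {β : Fin n → ℕ} (hα : α j = 1) :
    sgn k β j * weight q χ j (degree α β) =
      cL q β j * mulL q j (dn α j) + cR q β j * χ j * mulR q j (dn α j) := by
  have hL : mulL q j (dn α j) = ∏ l ∈ Finset.Iio j, (-q.val l j)⁻¹ ^ (α l : ℕ) :=
    Finset.prod_congr rfl fun l hl => by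
      rw [dn_ne α (Finset.mem_Iio.1 hl).ne, q.symm l j, inv_neg]
  have hR : mulR q j (dn α j) = ∏ l ∈ Finset.Ioi j, (-q.val j l)⁻¹ ^ (α l : ℕ) :=
    Finset.prod_congr rfl fun l hl => by
      rw [dn_ne α (Finset.mem_Ioi.1 hl).ne', q.symm j l, inv_neg]
  have hcL : cL q β j = sgn k β j * ∏ l ∈ Finset.Iio j, (-q.val l j) ^ β l := by
    rw [sgn, ← Finset.prod_pow_eq_pow_sum, ← Finset.prod_mul_distrib]
    exact Finset.prod_congr rfl fun l _ => by rw [← mul_pow, neg_one_mul, neg_neg]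
  have hcR : cR q β j = sgn k β j * ((-1) ^ β j * ∏ l ∈ Finset.Ioi j, (-q.val j l) ^ β l) := by
    rw [cR, sgn, ← Finset.sum_erase_add _ _ (Finset.mem_Iic.2 (le_refl j)), pow_add,
      Finset.Iic_erase, mul_assoc]
  have hj : (-1 : k) ^ degree α β j = -(-1) ^ β j := by
    rw [degree, hα, zpow_sub₀ (by simp)]
    simp [div_neg]
  rw [weight, prod_neg_val_zpow_degree _ _ (fun l => neg_val_ne_zero q l j),
    prod_neg_val_zpow_degree _ _ (fun l => neg_val_ne_zero q j l), hL, hR, hcL, hcR, hj]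
  ring

end Coefficients

end QCI
end HHQuantum
end

/-! ### Cohomology with coefficients in Λ ⊗ g. -/

noncomputable section
namespace HHQuantum
namespace QCI

open scoped ModuleCat

variable {k : Type u} [Field k] {n : ℕ} (q : QCoeff k n)
variable {G : Type u} [Group G] [MulSemiringAction G (QCI q)] [SMulCommClass G k (QCI q)] (g : G)

/-- The underlying element of `Λ_q` of an element of `Λ_q ⊗ g`. -/
def twistVal : twistBimod k (QCI q) g →+ QCI q := AddMonoidHom.id (QCI q)

lemma twistVal_smul (a : QCI q) (b : (QCI q)ᵐᵒᵖ) (y : twistBimod k (QCI q) g) :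
    twistVal q g ((a ⊗ₜ[k] b : Env k (QCI q)) • y) = a * (twistVal q g y * g • b.unop) := rfl

lemma twistVal_injective : Function.Injective (twistVal q g) := fun _ _ h => h

lemma twistVal_twistElt (y : QCI q) : twistVal q g (twistElt k (QCI q) g y) = y := rfl

lemma twistVal_scalar_smul (c : k) (y : twistBimod k (QCI q) g) :
    twistVal q g (c • y) = c • twistVal q g y := by
  have h : c • y = ((c • (1 : QCI q)) ⊗ₜ[k] (1 : (QCI q)ᵐᵒᵖ) : Env k (QCI q)) • y := by
    rw [← TensorProduct.smul_tmul', ← Algebra.TensorProduct.one_def, ← Algebra.algebraMap_eq_smul_one]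
    rfl
  rw [h, twistVal_smul]
  simp

/-- A cochain as a linear map. -/
def cochainMap {m : ℕ} (f : (K q).X m ⟶ twistBimod k (QCI q) g) :
    KX q m →ₗ[Env k (QCI q)] twistBimod k (QCI q) g := f.hom

/-- The value of a cochain at `ε_β`. -/
def evalEps (m : ℕ) (β : Fin n → ℕ) :
    ((K q).X m ⟶ twistBimod k (QCI q) g) →ₗ[k] QCI q where
  toFun f := twistVal q g (cochainMap q g f (eps q m β))
  map_add' _ _ := (twistVal q g).map_add _ _
  map_smul' c _ := twistVal_scalar_smul q g c _

lemma evalEps_apply (m : ℕ) (β : Fin n → ℕ) (f : (K q).X m ⟶ twistBimod k (QCI q) g) :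
    evalEps q g m β f = twistVal q g (cochainMap q g f (eps q m β)) := rfl

lemma evalEps_of_ne {m : ℕ} {β : Fin n → ℕ} (h : ∑ i, β i ≠ m)
    (f : (K q).X m ⟶ twistBimod k (QCI q) g) : evalEps q g m β f = 0 := by
  rw [evalEps_apply, eps, dif_neg h, map_zero, map_zero]

lemma evalEps_ext {m : ℕ} {f f' : (K q).X m ⟶ twistBimod k (QCI q) g}
    (h : ∀ β : MIdx n m, evalEps q g m β.1 f = evalEps q g m β.1 f') : f = f' := by
  refine ModuleCat.hom_ext (Finsupp.lhom_ext' fun β => LinearMap.ext_ring ?_)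
  have := h β
  rw [evalEps_apply, evalEps_apply, eps, dif_pos β.2] at this
  exact twistVal_injective q g this

/-- The only place where g enters the differential: right multiplication by x_j is twisted by g and
picks up χ_j. -/
lemma twistVal_cof_smul (χ : Fin n → k) (hχ : ∀ i, g • x q i = χ i • x q i)
    (β : Fin n → ℕ) (j : Fin n) (y : twistBimod k (QCI q) g) :
    twistVal q g (cof q β j • y) = cL q β j • (x q j * twistVal q g y) +
      (cR q β j * χ j) • (twistVal q g y * x q j) := by
  have h1 : cof q β j = (cL q β j • x q j) ⊗ₜ[k] (1 : (QCI q)ᵐᵒᵖ) +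
      (1 : QCI q) ⊗ₜ[k] MulOpposite.op (cR q β j • x q j) := by
    rw [cof, TensorProduct.smul_tmul', MulOpposite.op_smul, TensorProduct.tmul_smul]
  rw [h1, add_smul, map_add, twistVal_smul, twistVal_smul]
  simp only [MulOpposite.unop_one, smul_one, mul_one, MulOpposite.unop_op, one_mul,
    smul_comm g (cR q β j), hχ, smul_mul_assoc, mul_smul_comm, smul_smul]

lemma cochainMap_d {m : ℕ} (f : (K q).X m ⟶ twistBimod k (QCI q) g) :
    cochainMap q g ((K q).d (m + 1) m ≫ f) = cochainMap q g f ∘ₗ dK q m := by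
  rw [K_d q m]
  rfl

lemma evalEps_d (χ : Fin n → k) (hχ : ∀ i, g • x q i = χ i • x q i) {m : ℕ} {β : Fin n → ℕ}
    (h : ∑ i, β i = m + 1) (f : (K q).X m ⟶ twistBimod k (QCI q) g) :
    evalEps q g (m + 1) β ((K q).d (m + 1) m ≫ f) = ∑ j, if β j = 0 then 0 else
      cL q β j • (x q j * evalEps q g m (dec β j) f) +
        (cR q β j * χ j) • (evalEps q g m (dec β j) f * x q j) := by
  rw [evalEps_apply, cochainMap_d, LinearMap.comp_apply, dK_eps q m β h, dEps, map_sum, map_sum]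
  refine Finset.sum_congr rfl fun j _ => ?_
  split_ifs
  · rw [map_zero, map_zero]
  · rw [map_smul, twistVal_cof_smul q g χ hχ β j]
    rfl

/-- The coefficient of `(x^α ⊗ g) ε_β^*` in a cochain. -/
def coeff (m : ℕ) (α : Fin n → Fin 2) (β : Fin n → ℕ) :
    ((K q).X m ⟶ twistBimod k (QCI q) g) →ₗ[k] k :=
  (monoBasis q).coord α ∘ₗ evalEps q g m β

lemma coeff_apply {m : ℕ} (α : Fin n → Fin 2) (β : Fin n → ℕ)
    (f : (K q).X m ⟶ twistBimod k (QCI q) g) :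
    coeff q g m α β f = (monoBasis q).coord α (evalEps q g m β f) := rfl

lemma coeff_of_ne {m : ℕ} (α : Fin n → Fin 2) {β : Fin n → ℕ} (h : ∑ i, β i ≠ m)
    (f : (K q).X m ⟶ twistBimod k (QCI q) g) : coeff q g m α β f = 0 := by
  rw [coeff_apply, evalEps_of_ne q g h, map_zero]

lemma coeff_ext {m : ℕ} {f f' : (K q).X m ⟶ twistBimod k (QCI q) g}
    (h : ∀ α β, ∑ i, β i = m → coeff q g m α β f = coeff q g m α β f') : f = f' :=
  evalEps_ext q g fun β => (monoBasis q).ext_elem fun α => h α β.1 β.2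

lemma coord_mono (α α' : Fin n → Fin 2) :
    (monoBasis q).coord α (mono q α') = if α' = α then 1 else 0 := by
  rw [← monoBasis_apply, Module.Basis.coord_apply, Module.Basis.repr_self, Finsupp.single_apply]

lemma up_eq_iff {α α' : Fin n → Fin 2} {j : Fin n} :
    (α' j = 0 ∧ up α' j = α) ↔ (α j = 1 ∧ α' = dn α j) := by
  constructor
  · rintro ⟨h, rfl⟩
    exact ⟨up_self α' j, (dn_up h).symm⟩
  · rintro ⟨h, rfl⟩
    exact ⟨dn_self α j, up_dn h⟩

lemma coord_x_mul (α : Fin n → Fin 2) (j : Fin n) (y : QCI q) :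
    (monoBasis q).coord α (x q j * y) =
      if α j = 1 then mulL q j (dn α j) * (monoBasis q).coord (dn α j) y else 0 := by
  have hy : y ∈ Submodule.span k (Set.range (mono q)) := span_mono q ▸ trivial
  induction hy using Submodule.span_induction with
  | zero => simp
  | add y z _ _ hy hz => rw [mul_add, map_add, hy, hz, map_add]; split_ifs <;> ring
  | smul c y _ hy =>
    rw [mul_smul_comm, map_smul, hy, map_smul, smul_eq_mul, smul_eq_mul]
    split_ifs <;> ring
  | mem y hy =>
    obtain ⟨α', rfl⟩ := hy
    have h := up_eq_iff (α := α) (α' := α') (j := j)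
    rw [x_mul_mono, coord_mono, apply_ite ((monoBasis q).coord α), map_zero, map_smul, coord_mono]
    by_cases h1 : α' j = 0 ∧ up α' j = α
    · have h2 := h.1 h1
      rw [if_pos h1.1, if_pos h1.2, if_pos h2.1, if_pos h2.2, h2.2, smul_eq_mul]
    · have h2 := mt h.2 h1
      split_ifs <;> simp_all

lemma coord_mul_x (α : Fin n → Fin 2) (j : Fin n) (y : QCI q) :
    (monoBasis q).coord α (y * x q j) =
      if α j = 1 then mulR q j (dn α j) * (monoBasis q).coord (dn α j) y else 0 := by
  have hy : y ∈ Submodule.span k (Set.range (mono q)) := span_mono q ▸ trivial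
  induction hy using Submodule.span_induction with
  | zero => simp
  | add y z _ _ hy hz => rw [add_mul, map_add, hy, hz, map_add]; split_ifs <;> ring
  | smul c y _ hy =>
    rw [smul_mul_assoc, map_smul, hy, map_smul, smul_eq_mul, smul_eq_mul]
    split_ifs <;> ring
  | mem y hy =>
    obtain ⟨α', rfl⟩ := hy
    have h := up_eq_iff (α := α) (α' := α') (j := j)
    rw [mono_mul_x, coord_mono, apply_ite ((monoBasis q).coord α), map_zero, map_smul, coord_mono]
    by_cases h1 : α' j = 0 ∧ up α' j = α
    · have h2 := h.1 h1
      rw [if_pos h1.1, if_pos h1.2, if_pos h2.1, if_pos h2.2, h2.2, smul_eq_mul]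
    · have h2 := mt h.2 h1
      split_ifs <;> simp_all

/-- In coordinates, Hom(K, Λ ⊗ g) is the cube complex with weights `weight`. Outside |β| = m + 1
both sides are zero. -/
lemma coeff_d (χ : Fin n → k) (hχ : ∀ i, g • x q i = χ i • x q i) {m : ℕ}
    (f : (K q).X m ⟶ twistBimod k (QCI q) g) (α : Fin n → Fin 2) (β : Fin n → ℕ) :
    coeff q g (m + 1) α β ((K q).d (m + 1) m ≫ f) =
      cubeD (weight q χ) (fun α β => coeff q g m α β f) α β := by
  by_cases h : ∑ i, β i = m + 1
  · rw [coeff_apply, evalEps_d q g χ hχ h, map_sum]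
    refine Finset.sum_congr rfl fun j _ => ?_
    by_cases hβ : β j = 0
    · simp [hβ]
    · rw [if_neg hβ, map_add, map_smul, map_smul, coord_x_mul, coord_mul_x]
      by_cases hα : α j = 1
      · rw [if_pos hα, if_pos hα, if_pos ⟨hα, hβ⟩, sgn_mul_weight q χ hα, smul_eq_mul,
          smul_eq_mul]
        beta_reduce
        rw [coeff_apply]
        ring
      · simp [hα]
  · rw [coeff_of_ne q g α h]
    refine (Finset.sum_eq_zero fun j _ => ?_).symm
    split_ifs with h1
    · beta_reduce
      rw [coeff_of_ne q g, mul_zero]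
      intro h2
      have := sum_dec Finset.univ h1.2 (Finset.mem_univ j)
      omega
    · rfl

/-- The cochain with prescribed values at the `ε_β`. -/
def cochainOf {m : ℕ} (v : MIdx n m → twistBimod k (QCI q) g) :
    (K q).X m ⟶ twistBimod k (QCI q) g :=
  ModuleCat.ofHom (X := KX q m) (Y := twistBimod k (QCI q) g)
    (Finsupp.linearCombination (Env k (QCI q)) v)

lemma evalEps_cochainOf {m : ℕ} (v : MIdx n m → twistBimod k (QCI q) g) (β : MIdx n m) :
    evalEps q g m β.1 (cochainOf q g v) = twistVal q g (v β) := by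
  rw [evalEps_apply, eps, dif_pos β.2]
  exact congrArg _ ((Finsupp.linearCombination_single _ _ _).trans (one_smul _ _))

lemma exists_coeff_eq (m : ℕ) (F : (Fin n → Fin 2) → (Fin n → ℕ) → k) :
    ∃ f : (K q).X m ⟶ twistBimod k (QCI q) g, ∀ α β, ∑ i, β i = m →
      coeff q g m α β f = F α β := by
  refine ⟨cochainOf q g fun β : MIdx n m =>
      twistElt k (QCI q) g ((monoBasis q).equivFun.symm fun α => F α β.1), fun α β h => ?_⟩
  have := evalEps_cochainOf q g (fun β : MIdx n m =>
      twistElt k (QCI q) g ((monoBasis q).equivFun.symm fun α => F α β.1)) ⟨β, h⟩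
  rw [coeff_apply, this, twistVal_twistElt, Module.Basis.coord_equivFun_symm]

lemma coeff_cochain {m : ℕ} (α : Fin n → Fin 2) (β : MIdx n m) (α' : Fin n → Fin 2)
    (β' : MIdx n m) :
    coeff q g m α' β'.1 (cochain q g α β) = if α = α' ∧ β = β' then 1 else 0 := by
  have : evalEps q g m β'.1 (cochain q g α β) = twistVal q g (if β' = β then _ else _) :=
    evalEps_cochainOf q g _ β'
  rw [coeff_apply, this, apply_ite (twistVal q g), twistVal_twistElt, map_zero,
    apply_ite ((monoBasis q).coord α'), map_zero, coord_mono]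
  by_cases h : β' = β
  · subst h; simp
  · simp [h, Ne.symm h]

instance finite_MIdx (m : ℕ) : Finite (MIdx n m) := by
  refine Finite.of_injective (β := Fin n → Fin (m + 1))
    (fun β i => ⟨β.1 i, Nat.lt_succ_of_le ((Finset.single_le_sum (fun _ _ => Nat.zero_le _)
      (Finset.mem_univ i)).trans_eq β.2)⟩) fun β β' h => ?_
  exact Subtype.ext (funext fun i => congrArg Fin.val (congrFun h i))

variable {q} in
-- A summand of the coboundary is nonzero only if it starts at the index of the cochain; it then
-- lies in the same multidegree, where membership in C_g kills it.
lemma d_cochain (χ : Fin n → k) (hχ : ∀ i, g • x q i = χ i • x q i) {m : ℕ} (p : BIdx q χ m) :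
    (K q).d (m + 1) m ≫ cochain q g p.1.1 p.1.2 = 0 := by
  refine coeff_ext q g fun α β h => ?_
  rw [coeff_d q g χ hχ, map_zero]
  refine Finset.sum_eq_zero fun j _ => ?_
  split_ifs with h1
  · have h2 := coeff_cochain q g p.1.1 p.1.2 (dn α j) ⟨dec β j, sum_dec_of_eq h1.2 h⟩
    simp only at h2 ⊢
    rw [h2]
    split_ifs with h3
    · have h4 := (mem_C_iff q χ _ _).1 p.2 j
      have h5 : degree p.1.1 p.1.2.1 = degree α β := by
        rw [h3.1, h3.2, degree_dn_dec h1.1 h1.2]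
      rw [h5] at h4
      rcases h4 with h4 | h4
      · have : degree α β j = (β j : ℤ) - 1 := by simp [degree, h1.1]
        have := h1.2
        omega
      · rw [h4, mul_zero, zero_mul]
    · rw [mul_zero]
  · rfl

/-- The cocycles that give the basis of cohomology. -/
def basicCocycle (χ : Fin n → k) (hχ : ∀ i, g • x q i = χ i • x q i) (m : ℕ) (p : BIdx q χ m) :
    cocycleSubmodule (k := k) (K q) (twistBimod k (QCI q) g) m :=
  ⟨cochain q g p.1.1 p.1.2, d_cochain g χ hχ p⟩

/-- The class map from cocycles to Hochschild cohomology. -/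
def classMap (m : ℕ) :
    cocycleSubmodule (k := k) (K q) (twistBimod k (QCI q) g) m →ₗ[k]
      HH k (QCI q) (twistBimod k (QCI q) g) m :=
  extMkLinear (Kres q (quasiIso_Kπ q)) _ m

/-- Coboundaries have no component in multidegrees of C_g, because the differential is zero there.
Degree 0 has no nonzero coboundaries. -/
lemma coeff_eq_zero_of_class (χ : Fin n → k) (hχ : ∀ i, g • x q i = χ i • x q i) {m : ℕ}
    (z : cocycleSubmodule (k := k) (K q) (twistBimod k (QCI q) g) m)
    (hz : classMap q g m z = 0) (α : Fin n → Fin 2) (β : Fin n → ℕ) (h : degree α β ∈ C q χ) :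
    coeff q g m α β z.1 = 0 := by
  cases m with
  | zero =>
    have : z.1 = 0 := (extMk_zero_eq_zero_iff (Kres q (quasiIso_Kπ q)) z.1 (d_comp_cocycle z)).1 hz
    rw [this, map_zero]
  | succ m =>
    obtain ⟨y, hy⟩ : ∃ y : (K q).X m ⟶ twistBimod k (QCI q) g, (K q).d (m + 1) m ≫ y = z.1 :=
      ((Kres q (quasiIso_Kπ q)).extMk_eq_zero_iff z.1 (m + 2) rfl (d_comp_cocycle z) m rfl).1 hz
    rw [← hy, coeff_d q g χ hχ]
    exact cubeD_eq_zero _ ((mem_C_iff q χ α β).1 h)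

/-- Without components in C_g, a cocycle lives on contractible cubes and is the coboundary of its
contraction `cubeH`. -/
lemma class_eq_zero_of_coeff (χ : Fin n → k) (hχ : ∀ i, g • x q i = χ i • x q i) {m : ℕ}
    (z : cocycleSubmodule (k := k) (K q) (twistBimod k (QCI q) g) m)
    (hz : ∀ α β, degree α β ∈ C q χ → coeff q g m α β z.1 = 0) : classMap q g m z = 0 := by
  have hd : (K q).d (m + 1) m ≫ z.1 = 0 := z.2
  have h1 : ∀ α β, cubeD (weight q χ) (fun α β => coeff q g m α β z.1) α β = 0 := fun α β => by
    rw [← coeff_d q g χ hχ, hd, map_zero]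
  have h2 := cubeD_cubeH (weight q χ) _ h1 fun α β h => hz α β ((mem_C_iff q χ α β).2 h)
  have h3 : ∀ α β, ∑ i, β i + 1 ≠ m → cubeH (weight q χ) (fun α β => coeff q g m α β z.1) α β = 0 :=
    cubeH_of_sum_ne _ fun α β h => coeff_of_ne q g α h _
  cases m with
  | zero =>
    refine (extMk_zero_eq_zero_iff (Kres q (quasiIso_Kπ q)) z.1 (d_comp_cocycle z)).2 ?_
    refine coeff_ext q g (f' := (0 : (K q).X 0 ⟶ _)) fun α β _ => ?_
    rw [map_zero, ← h2 α β]
    -- In degree 0 the contraction would live at |β| = -1, so it is zero, and the cocycle with it.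
    refine Finset.sum_eq_zero fun j _ => ?_
    split_ifs
    · rw [h3 _ _ (Nat.succ_ne_zero _), mul_zero]
    · rfl
  | succ m =>
    obtain ⟨y, hy⟩ := exists_coeff_eq q g m (cubeH (weight q χ) fun α β => coeff q g (m + 1) α β z.1)
    refine ((Kres q (quasiIso_Kπ q)).extMk_eq_zero_iff z.1 (m + 2) rfl
      (d_comp_cocycle z) m rfl).2 ⟨y, ?_⟩
    change (K q).d (m + 1) m ≫ y = z.1
    refine coeff_ext q g fun α β h => ?_
    rw [coeff_d q g χ hχ, ← h2 α β]
    congr 1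
    funext α β
    by_cases h4 : ∑ i, β i = m
    · exact hy α β h4
    · rw [coeff_of_ne q g α h4, h3]
      omega

/-- The basis of `HH^m(Λ, Λ ⊗ g)`. -/
def basisHH (χ : Fin n → k) (hχ : ∀ i, g • x q i = χ i • x q i) (m : ℕ) :
    Module.Basis (BIdx q χ m) k (HH k (QCI q) (twistBimod k (QCI q) g) m) := by
  have hfin : Fintype (BIdx q χ m) := Fintype.ofFinite _
  -- The coefficients at indices of C_g are dual to the basic cocycles, which yields both
  -- independence and spanning.
  have hcoeff : ∀ (c : BIdx q χ m → k) (p : BIdx q χ m),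
      coeff q g m p.1.1 p.1.2.1 (∑ p, c p • basicCocycle q g χ hχ m p).1 = c p := by
    intro c p
    rw [Submodule.coe_sum, map_sum, Finset.sum_eq_single p]
    · change coeff q g m p.1.1 p.1.2.1 (c p • cochain q g p.1.1 p.1.2) = c p
      rw [map_smul, coeff_cochain]
      simp
    · intro p' _ hp
      change coeff q g m p.1.1 p.1.2.1 (c p' • cochain q g p'.1.1 p'.1.2) = 0
      rw [map_smul, coeff_cochain, if_neg, smul_zero]
      exact fun h => hp (Subtype.ext (Prod.ext h.1 h.2))
    · simp
  refine Module.Basis.mk (v := fun p => classMap q g m (basicCocycle q g χ hχ m p)) ?_ ?_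
  · rw [Fintype.linearIndependent_iff]
    intro c hc p
    have h : classMap q g m (∑ p, c p • basicCocycle q g χ hχ m p) = 0 := by
      rw [map_sum, ← hc]
      exact Finset.sum_congr rfl fun p _ => map_smul _ _ _
    rw [← hcoeff c p]
    exact coeff_eq_zero_of_class q g χ hχ _ h _ _ p.2
  · rintro e -
    obtain ⟨z, rfl⟩ : ∃ z, classMap q g m z = e := by
      obtain ⟨f, hf, rfl⟩ := (Kres q (quasiIso_Kπ q)).extMk_surjective e (m + 1) rfl
      exact ⟨⟨f, hf⟩, rfl⟩
    -- `w` is the part of the cocycle `z` in multidegrees of C_g; the difference has no such part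
    -- and is therefore a coboundary.
    set w := ∑ p : BIdx q χ m, coeff q g m p.1.1 p.1.2.1 z.1 • basicCocycle q g χ hχ m p
    have h : classMap q g m (z - w) = 0 := by
      refine class_eq_zero_of_coeff q g χ hχ _ fun α β h => ?_
      by_cases hm : ∑ i, β i = m
      · have := hcoeff (fun p => coeff q g m p.1.1 p.1.2.1 z.1) ⟨(α, ⟨β, hm⟩), h⟩
        change coeff q g m α β (z.1 - w.1) = 0
        rw [map_sub, sub_eq_zero]
        exact this.symm
      · exact coeff_of_ne q g α hm _
    rw [map_sub, sub_eq_zero] at h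
    rw [h, map_sum]
    refine Submodule.sum_mem _ fun p _ => ?_
    rw [map_smul]
    exact Submodule.smul_mem _ _ (Submodule.subset_span ⟨p, rfl⟩)

lemma basisHH_apply (χ : Fin n → k) (hχ : ∀ i, g • x q i = χ i • x q i) (m : ℕ)
    (p : BIdx q χ m) : basisHH q g χ hχ m p =
      (Kres q (quasiIso_Kπ q)).extMk (cochain q g p.1.1 p.1.2) (m + 1) rfl (d_cochain g χ hχ p) := by
  rw [basisHH, Module.Basis.mk_apply]
  rfl

end QCI
end HHQuantum
end

/-! ### Decomposition of the cohomology with coefficients in A ⋊ G. -/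

noncomputable section
namespace HHQuantum

open Abelian

lemma sum_single_coeff {A G : Type*} [Ring A] [Fintype G] (b : SkewMonoidAlgebra A G) :
    ∑ g : G, SkewMonoidAlgebra.single g (b.coeff g) = b := by
  refine SkewMonoidAlgebra.coeff_injective ?_
  rw [← SkewMonoidAlgebra.coeffAddEquiv_apply, map_sum]
  exact Finsupp.univ_sum_single _

variable (k : Type u) [Field k] (A : Type u) [Ring A] [Algebra k A]
variable {G : Type u} [Group G] [MulSemiringAction G A] [SMulCommClass G k A]

lemma coeff_incl_mul (g : G) (a b : A) (s : SkewMonoidAlgebra A G) :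
    (SkewMonoidAlgebra.single 1 a * (s * SkewMonoidAlgebra.single 1 b)).coeff g =
      a * (s.coeff g * g • b) := by
  rw [SkewMonoidAlgebra.coeff_single_one_mul, SkewMonoidAlgebra.coeff_mul_single_one]

/-- The projection of `A ⋊ G` onto `A ⊗ g`. -/
def twistProj (g : G) : skewBimod k A G ⟶ twistBimod k A g :=
  mkBimodHom (M := skewBimod k A G) (N := twistBimod k A g)
    (show SkewMonoidAlgebra A G →+ A from
      (Finsupp.applyAddHom g).comp SkewMonoidAlgebra.coeffAddEquiv.toAddMonoidHom)
    (fun a b c => coeff_incl_mul A g a b.unop c)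

lemma twistIncl_twistProj (g : G) : twistIncl k A g ≫ twistProj k A g = 𝟙 _ := by
  refine ModuleCat.hom_ext (LinearMap.ext fun y => ?_)
  change (SkewMonoidAlgebra.single g (show A from y)).coeff g = y
  rw [SkewMonoidAlgebra.coeff_single, Finsupp.single_eq_same]

lemma twistIncl_twistProj_of_ne {g h : G} (hgh : g ≠ h) :
    twistIncl k A g ≫ twistProj k A h = 0 := by
  refine ModuleCat.hom_ext (LinearMap.ext fun y => ?_)
  change (SkewMonoidAlgebra.single g (show A from y)).coeff h = 0
  rw [SkewMonoidAlgebra.coeff_single, Finsupp.single_eq_of_ne hgh.symm]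

/-- With the two lemmas above, this exhibits A ⋊ G as a finite biproduct, which the additive functor
Ext carries over to `skewEquiv`. -/
lemma sum_twistProj_twistIncl [Fintype G] :
    ∑ g : G, twistProj k A g ≫ twistIncl k A g = 𝟙 (skewBimod k A G) := by
  refine ModuleCat.hom_ext (LinearMap.ext fun y => ?_)
  rw [ModuleCat.hom_sum, LinearMap.sum_apply]
  change ∑ g : G, SkewMonoidAlgebra.single g ((show SkewMonoidAlgebra A G from y).coeff g) =
    (show SkewMonoidAlgebra A G from y)
  exact sum_single_coeff _

/-- Postcomposition with a morphism, as a linear map. -/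
def postcompLinear {X Y Z : ModuleCat.{u} (Env k A)} (f : Y ⟶ Z) (m : ℕ) :
    Ext.{u} X Y m →ₗ[k] Ext.{u} X Z m where
  toFun e := e.comp (Ext.mk₀ f) (add_zero m)
  map_add' e e' := by simp
  map_smul' c e := by simp

lemma postcompLinear_comp {X Y Z W : ModuleCat.{u} (Env k A)} (f : Y ⟶ Z) (g : Z ⟶ W) (m : ℕ)
    (e : Ext.{u} X Y m) :
    postcompLinear k A g m (postcompLinear k A f m e) = postcompLinear k A (f ≫ g) m e := by
  simp [postcompLinear]

/-- `HH^m(A, A ⋊ G)` is the product of the `HH^m(A, A ⊗ g)`. -/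
def skewEquiv [Finite G] (m : ℕ) :
    HH k A (skewBimod k A G) m ≃ₗ[k] ∀ g : G, HH k A (twistBimod k A g) m :=
  letI := Fintype.ofFinite G
  LinearEquiv.ofLinearMap
    (LinearMap.pi fun g => postcompLinear k A (twistProj k A g) m)
    (∑ g : G, postcompLinear k A (twistIncl k A g) m ∘ₗ LinearMap.proj g)
    (by
      refine LinearMap.ext fun e => funext fun h => ?_
      rw [LinearMap.comp_apply, LinearMap.pi_apply, LinearMap.sum_apply, map_sum,
        Finset.sum_eq_single h]
      · rw [LinearMap.comp_apply, postcompLinear_comp, twistIncl_twistProj]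
        simp [postcompLinear]
      · intro g _ hg
        rw [LinearMap.comp_apply, postcompLinear_comp, twistIncl_twistProj_of_ne k A hg]
        simp [postcompLinear]
      · simp)
    (by
      refine LinearMap.ext fun e => ?_
      rw [LinearMap.comp_apply, LinearMap.sum_apply]
      have h : ∀ g ∈ (Finset.univ : Finset G), (postcompLinear k A (twistIncl k A g) m ∘ₗ
          LinearMap.proj g) ((LinearMap.pi fun g => postcompLinear k A (twistProj k A g) m) e) =
          postcompLinear k A (twistProj k A g ≫ twistIncl k A g) m e :=
        fun g _ => postcompLinear_comp k A _ _ m e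
      rw [Finset.sum_congr rfl h]
      have h2 := congrArg (fun f => postcompLinear k A f m e) (sum_twistProj_twistIncl k A (G := G))
      simp only [postcompLinear, LinearMap.coe_mk, AddHom.coe_mk, Ext.mk₀_sum, Ext.comp_sum,
        Ext.comp_mk₀_id] at h2 ⊢
      exact h2)

lemma skewEquiv_symm_single [Finite G] [DecidableEq G] (m : ℕ) (g : G)
    (e : HH k A (twistBimod k A g) m) :
    (skewEquiv k A m).symm (Pi.single g e) =
      e.comp (Ext.mk₀ (twistIncl k A g)) (add_zero m) := by
  let := Fintype.ofFinite G
  change (∑ g : G, postcompLinear k A (twistIncl k A g) m ∘ₗ LinearMap.proj g) (Pi.single g e) = _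
  rw [LinearMap.sum_apply, Finset.sum_eq_single g]
  · simp [postcompLinear]
  · intro h _ hg
    rw [LinearMap.comp_apply, LinearMap.proj_apply, Pi.single_eq_of_ne hg, map_zero]
  · simp

/-- The basis of `HH^m(A, A ⋊ G)` obtained from bases of the `HH^m(A, A ⊗ g)`. -/
def skewBasis [Finite G] {ι : G → Type*} (m : ℕ)
    (b : ∀ g : G, Module.Basis (ι g) k (HH k A (twistBimod k A g) m)) :
    Module.Basis (Σ g : G, ι g) k (HH k A (skewBimod k A G) m) :=
  letI := Fintype.ofFinite G
  (Pi.basis b).map (skewEquiv k A m).symm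

lemma skewBasis_apply [Finite G] {ι : G → Type*} (m : ℕ)
    (b : ∀ g : G, Module.Basis (ι g) k (HH k A (twistBimod k A g) m)) (g : G) (i : ι g) :
    skewBasis k A m b ⟨g, i⟩ =
      (b g i).comp (Ext.mk₀ (twistIncl k A g)) (add_zero m) := by
  classical
  let := Fintype.ofFinite G
  rw [skewBasis, Module.Basis.map_apply, Pi.basis_apply, skewEquiv_symm_single]

end HHQuantum
end

/-! ### Bimodules over A ⋊ G that are injective over A as well. -/

noncomputable section
namespace HHQuantum

section Injective

variable {k R S : Type u} [Field k] [Ring R] [Ring S] [Algebra k R] [Algebra k S]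

/-- The `R`-module of `k`-linear maps from `R` to `V`. -/
abbrev coind (R : Type u) [Ring R] [Algebra k R] (V : ModuleCat.{u} k) : ModuleCat.{u} R :=
  (ModuleCat.coextendScalars (algebraMap k R)).obj V

/-- Coinduction is right adjoint to restriction, which preserves monomorphisms, and every vector
space is injective. -/
lemma injective_coind (V : ModuleCat.{u} k) : Injective (coind R V) := by
  have : Injective V := (Module.injective_iff_injective_object k V).1
    (Module.injective_of_isSemisimpleRing k V)
  exact Injective.injective_of_adjoint
    (ModuleCat.restrictCoextendScalarsAdj.{u, u, u} (algebraMap k R)) V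

/-- A `k`-linear map from `R` to `V`, as an element of `coind R V`. -/
def coindMk {V : ModuleCat.{u} k} (φ : R →+ V)
    (hφ : ∀ (c : k) (x : R), φ (algebraMap k R c * x) = c • φ x) : coind R V :=
  (ModuleCat.CoextendScalars.equiv (algebraMap k R) V).symm
    { toFun := fun x : R => φ x
      map_add' := fun x y : R => map_add φ x y
      map_smul' := fun c (x : R) => hφ c x }

/-- Evaluation of elements of `coind R V`. -/
def coindEval {V : ModuleCat.{u} k} (ψ : coind R V) : R →+ V where
  toFun x := ModuleCat.CoextendScalars.equiv (algebraMap k R) V ψ x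
  map_zero' := map_zero (ModuleCat.CoextendScalars.equiv (algebraMap k R) V ψ)
  map_add' := map_add (ModuleCat.CoextendScalars.equiv (algebraMap k R) V ψ)

lemma coindEval_algebraMap_mul {V : ModuleCat.{u} k} (ψ : coind R V) (c : k) (x : R) :
    coindEval ψ (algebraMap k R c * x) = c • coindEval ψ x :=
  (ModuleCat.CoextendScalars.equiv (algebraMap k R) V ψ).map_smul' c x

lemma coind_ext {V : ModuleCat.{u} k} {ψ ψ' : coind R V}
    (h : ∀ x, coindEval ψ x = coindEval ψ' x) : ψ = ψ' :=
  ModuleCat.CoextendScalars.ext (LinearMap.ext h)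

/-- Precomposition with `r ↦ u * f r`. -/
def coindRestrict (f : R →ₐ[k] S) (V : ModuleCat.{u} k) (u : S) :
    (ModuleCat.restrictScalars f.toRingHom).obj (coind S V) ⟶ coind R V :=
  ModuleCat.ofHom (X := (ModuleCat.restrictScalars f.toRingHom).obj (coind S V))
    { toFun := fun ψ : coind S V => coindMk
        ((coindEval ψ).comp ((AddMonoidHom.mulLeft u).comp (f : R →+ S))) (fun c x => by
          change coindEval ψ (u * f (algebraMap k R c * x)) = c • coindEval ψ (u * f x)
          rw [map_mul f, f.commutes, ← mul_assoc, ← Algebra.commutes, mul_assoc,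
            coindEval_algebraMap_mul])
      map_add' := fun ψ ψ' : coind S V => rfl
      map_smul' := fun r (ψ : coind S V) => coind_ext fun x => by
        change coindEval ψ (u * f x * f r) = coindEval ψ (u * f (x * r))
        rw [map_mul f, mul_assoc] }

/-- Precomposition with a map `S → R` of right `R`-modules. -/
def coindExtend (f : R →ₐ[k] S) (V : ModuleCat.{u} k) (p : S →+ R)
    (hp : ∀ x r, p (x * f r) = p x * r) :
    coind R V ⟶ (ModuleCat.restrictScalars f.toRingHom).obj (coind S V) :=
  ModuleCat.ofHom (Y := (ModuleCat.restrictScalars f.toRingHom).obj (coind S V))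
    { toFun := fun ψ : coind R V => (show coind S V from coindMk
        ((coindEval ψ).comp p) (fun c x => by
          change coindEval ψ (p (algebraMap k S c * x)) = c • coindEval ψ (p x)
          rw [Algebra.commutes, ← f.commutes c, hp, ← Algebra.commutes, coindEval_algebraMap_mul]))
      map_add' := fun ψ ψ' : coind R V => rfl
      map_smul' := fun r (ψ : coind R V) => coind_ext (R := S) fun x => by
        change coindEval ψ (p x * r) = coindEval ψ (p (x * f r))
        rw [hp] }

/-- The u_j generate S as a right R-module, with coordinate maps p_j. Restricting a functional to
each u_j R and reassembling it exhibits Hom_k(S, V) as a retract of finitely many copies of the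
injective module Hom_k(R, V). -/
lemma injective_restrictScalars_coind (f : R →ₐ[k] S) (V : ModuleCat.{u} k) {J : Type*} [Fintype J]
    (u : J → S) (p : J → S →+ R) (hp : ∀ j x r, p j (x * f r) = p j x * r)
    (hu : ∀ x, ∑ j, u j * f (p j x) = x) :
    Injective ((ModuleCat.restrictScalars f.toRingHom).obj (coind S V)) := by
  have : Injective (coind R V) := injective_coind V
  refine ⟨fun {X Y} g i hi => ⟨∑ j, Injective.factorThru (g ≫ coindRestrict f V (u j)) i ≫
    coindExtend f V (p j) (hp j), ?_⟩⟩
  -- Reassembling the restrictions of a functional recovers it, by the expansion `hu` of its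
  -- argument.
  have h1 : ∑ j, coindRestrict f V (u j) ≫ coindExtend f V (p j) (hp j) = 𝟙 _ := by
    refine ModuleCat.hom_ext (LinearMap.ext fun ψ => ?_)
    rw [ModuleCat.hom_sum, LinearMap.sum_apply]
    refine coind_ext (R := S) fun x => ?_
    let ev : coind S V →+ V := ⟨⟨fun ψ => coindEval ψ x, rfl⟩, fun _ _ => rfl⟩
    refine (map_sum ev _ _).trans ?_
    change ∑ j, coindEval (R := S) ψ (u j * f (p j x)) = coindEval (R := S) ψ x
    rw [← map_sum, hu]
  have h2 : ∑ j, g ≫ coindRestrict f V (u j) ≫ coindExtend f V (p j) (hp j) = g := by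
    rw [← Preadditive.comp_sum, h1, Category.comp_id]
  rw [Preadditive.comp_sum]
  refine (Finset.sum_congr rfl fun j _ => ?_).trans h2
  rw [← Category.assoc, Injective.comp_factorThru, Category.assoc]

/-- The embedding of a module in a coinduced module. -/
def coindEmb (M : ModuleCat.{u} S) :
    M ⟶ coind S ((ModuleCat.restrictScalars (algebraMap k S)).obj M) :=
  (ModuleCat.restrictCoextendScalarsAdj.{u, u, u} (algebraMap k S)).unit.app M

/-- An element y goes to the functional s ↦ s y, whose value at 1 recovers it. -/
lemma mono_coindEmb (M : ModuleCat.{u} S) : Mono (coindEmb (k := k) M) := by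
  rw [ModuleCat.mono_iff_injective]
  intro y z h
  have h1 := congrArg (fun ψ => coindEval ψ (1 : S)) h
  have h2 : (1 : S) • y = (1 : S) • z := h1
  rwa [one_smul, one_smul] at h2

end Injective

section SkewEnv

variable {k : Type u} [Field k] {A : Type u} [Ring A] [Algebra k A]
variable {G : Type u} [Group G] [MulSemiringAction G A] [SMulCommClass G k A]

/-- The map `b ↦ g⁻¹ b_g` on `A ⋊ G`. -/
def leftCoord (g : G) : SkewMonoidAlgebra A G →ₗ[k] A where
  toFun b := g⁻¹ • b.coeff g
  map_add' b b' := by simp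
  map_smul' c b := by simp [smul_comm]

/-- The map `b ↦ b_g` on the opposite of `A ⋊ G`. -/
def rightCoord (g : G) : (SkewMonoidAlgebra A G)ᵐᵒᵖ →ₗ[k] Aᵐᵒᵖ where
  toFun b := MulOpposite.op (b.unop.coeff g)
  map_add' b b' := by simp
  map_smul' c b := by simp

/-- The coordinates of the enveloping algebra of `A ⋊ G` as a right module over that of `A`. -/
def envCoord (j : G × G) : Env k (SkewMonoidAlgebra A G) →ₗ[k] Env k A :=
  TensorProduct.map (leftCoord j.1) (rightCoord j.2)

variable (k A) in
/-- A basis of the enveloping algebra of `A ⋊ G` as a right module over that of `A`. -/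
def envGen (j : G × G) : Env k (SkewMonoidAlgebra A G) :=
  SkewMonoidAlgebra.single j.1 1 ⊗ₜ[k] MulOpposite.op (SkewMonoidAlgebra.single j.2 1)

lemma leftCoord_mul (g : G) (b : SkewMonoidAlgebra A G) (a : A) :
    leftCoord (k := k) g (b * skewIncl k A G a) = leftCoord (k := k) g b * a := by
  change g⁻¹ • (b * SkewMonoidAlgebra.single 1 a).coeff g = g⁻¹ • b.coeff g * a
  rw [SkewMonoidAlgebra.coeff_mul_single_one, smul_mul', inv_smul_smul]

lemma rightCoord_mul (g : G) (b : (SkewMonoidAlgebra A G)ᵐᵒᵖ) (a : Aᵐᵒᵖ) :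
    rightCoord (k := k) g (b * MulOpposite.op (skewIncl k A G a.unop)) =
      rightCoord (k := k) g b * a := by
  change MulOpposite.op ((SkewMonoidAlgebra.single 1 a.unop * b.unop).coeff g) =
    MulOpposite.op (a.unop * b.unop.coeff g)
  rw [SkewMonoidAlgebra.coeff_single_one_mul]

lemma envCoord_mul (j : G × G) (x : Env k (SkewMonoidAlgebra A G)) (r : Env k A) :
    envCoord j (x * envMap (skewIncl k A G) r) = envCoord j x * r := by
  induction x using TensorProduct.induction_on with
  | zero => simp
  | add x y hx hy => rw [add_mul, map_add, hx, hy, map_add, add_mul]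
  | tmul b b' =>
    induction r using TensorProduct.induction_on with
    | zero => simp
    | add x y hx hy => rw [map_add, mul_add, map_add, hx, hy, mul_add]
    | tmul a a' =>
      change envCoord j ((b ⊗ₜ[k] b' : Env k (SkewMonoidAlgebra A G)) *
        (skewIncl k A G a ⊗ₜ[k] MulOpposite.op (skewIncl k A G a'.unop))) =
        (leftCoord j.1 b ⊗ₜ[k] rightCoord j.2 b' : Env k A) * (a ⊗ₜ[k] a')
      rw [Algebra.TensorProduct.tmul_mul_tmul, Algebra.TensorProduct.tmul_mul_tmul, envCoord,
        TensorProduct.map_tmul, leftCoord_mul, rightCoord_mul]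

/-- The g⁻¹ in `leftCoord` undoes the twist from moving a coefficient past g. On the opposite side
coefficients already stand to the left of g, so `rightCoord` needs none. -/
lemma sum_leftCoord [Fintype G] (b : SkewMonoidAlgebra A G) :
    ∑ g : G, SkewMonoidAlgebra.single g 1 * skewIncl k A G (leftCoord (k := k) g b) = b := by
  have h : ∀ g : G, SkewMonoidAlgebra.single g 1 * skewIncl k A G (leftCoord (k := k) g b) =
      SkewMonoidAlgebra.single g (b.coeff g) := fun g => by
    change SkewMonoidAlgebra.single g 1 * SkewMonoidAlgebra.single 1 (g⁻¹ • b.coeff g) = _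
    simp [SkewMonoidAlgebra.single_mul_single]
  rw [Finset.sum_congr rfl fun g _ => h g, sum_single_coeff]

lemma sum_rightCoord [Fintype G] (b : (SkewMonoidAlgebra A G)ᵐᵒᵖ) :
    ∑ g : G, MulOpposite.op (SkewMonoidAlgebra.single g (1 : A)) *
      MulOpposite.op (skewIncl k A G (rightCoord (k := k) g b).unop) = b := by
  have h : ∀ g : G, MulOpposite.op (SkewMonoidAlgebra.single g (1 : A)) *
      MulOpposite.op (skewIncl k A G (rightCoord (k := k) g b).unop) =
      MulOpposite.op (SkewMonoidAlgebra.single g (b.unop.coeff g)) := fun g => by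
    change MulOpposite.op (SkewMonoidAlgebra.single 1 (b.unop.coeff g) *
      SkewMonoidAlgebra.single g 1) = _
    simp [SkewMonoidAlgebra.single_mul_single]
  rw [Finset.sum_congr rfl fun g _ => h g, ← Finset.op_sum, sum_single_coeff, MulOpposite.op_unop]

lemma sum_envCoord [Fintype G] (x : Env k (SkewMonoidAlgebra A G)) :
    ∑ j : G × G, envGen k A j * envMap (skewIncl k A G) (envCoord j x) = x := by
  induction x using TensorProduct.induction_on with
  | zero => simp
  | add x y hx hy =>
    simp only [map_add, mul_add, Finset.sum_add_distrib]
    rw [hx, hy]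
  | tmul b b' =>
    have h : ∀ j : G × G, envGen k A j * envMap (skewIncl k A G) (envCoord j (b ⊗ₜ[k] b')) =
        (SkewMonoidAlgebra.single j.1 1 * skewIncl k A G (leftCoord (k := k) j.1 b)) ⊗ₜ[k]
        (MulOpposite.op (SkewMonoidAlgebra.single j.2 (1 : A)) *
          MulOpposite.op (skewIncl k A G (rightCoord (k := k) j.2 b').unop)) := fun j => by
      rw [← Algebra.TensorProduct.tmul_mul_tmul]
      rfl
    rw [Finset.sum_congr rfl fun j _ => h j, Fintype.sum_prod_type]
    simp only [← TensorProduct.tmul_sum, ← TensorProduct.sum_tmul, sum_rightCoord, sum_leftCoord]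

variable (k A G) in
-- A single short exact sequence that allows dimension shifting over A ⋊ G and over A at once.
lemma exists_injective_embedding [Finite G]
    (M : ModuleCat.{u} (Env k (SkewMonoidAlgebra A G))) :
    ∃ (I N : ModuleCat.{u} (Env k (SkewMonoidAlgebra A G))) (i : M ⟶ I) (p : I ⟶ N) (w : i ≫ p = 0),
      (ShortComplex.mk i p w).ShortExact ∧ Injective I ∧
        Injective ((resBimod (skewIncl k A G)).obj I) := by
  let := Fintype.ofFinite G
  have := mono_coindEmb (k := k) M
  refine ⟨_, _, coindEmb (k := k) M, Limits.cokernel.π _, Limits.cokernel.condition _,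
    { exact := ShortComplex.exact_cokernel _ }, injective_coind _,
    injective_restrictScalars_coind (envMap (skewIncl k A G)) _ (envGen k A)
      (fun j => (envCoord j).toAddMonoidHom) envCoord_mul sum_envCoord⟩

end SkewEnv

end HHQuantum
end

/-! ### Restriction to A and the G-invariants. -/

noncomputable section
namespace HHQuantum

section Invariants

open Abelian

variable {k : Type u} [Field k] {A : Type u} [Ring A] [Algebra k A]
variable {G : Type u} [Group G] [MulSemiringAction G A] [SMulCommClass G k A]

section Restriction

variable {B : Type u} [Ring B] [Algebra k B] (f : A →ₐ[k] B)
variable {M N : ModuleCat.{u} (Env k B)}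

lemma resHH_comp {m n l : ℕ} (e : HH k B M m) (x : Ext.{u} M N n) (h : m + n = l) :
    resHH f N l (e.comp x h) = (resHH f M m e).comp (x.mapExactFunctor (resBimod f)) h := by
  change (Ext.mk₀ (resBimodUnit f)).comp ((e.comp x h).mapExactFunctor (resBimod f)) (zero_add l) =
    ((Ext.mk₀ (resBimodUnit f)).comp (e.mapExactFunctor (resBimod f)) (zero_add m)).comp
      (x.mapExactFunctor (resBimod f)) h
  rw [Ext.mapExactFunctor_comp, Ext.comp_assoc _ _ _ (zero_add m) h (by omega)]

lemma resHH_mk₀ (φ : selfBimod k B ⟶ M) :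
    resHH f M 0 (Ext.mk₀ φ) = Ext.mk₀ (resBimodUnit f ≫ (resBimod f).map φ) := by
  change (Ext.mk₀ (resBimodUnit f)).comp ((Ext.mk₀ φ).mapExactFunctor (resBimod f)) (zero_add 0) = _
  rw [Ext.mapExactFunctor_mk₀, Ext.mk₀_comp_mk₀]

end Restriction

variable (k A) in
/-- The element `h ⊗ h⁻¹` of the enveloping algebra of `A ⋊ G`. -/
def envConj (h : G) : Env k (SkewMonoidAlgebra A G) :=
  SkewMonoidAlgebra.single h 1 ⊗ₜ[k] MulOpposite.op (SkewMonoidAlgebra.single h⁻¹ 1)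

lemma single_mul_incl (h : G) (a : A) :
    SkewMonoidAlgebra.single h (1 : A) * SkewMonoidAlgebra.single 1 (h⁻¹ • a) =
      SkewMonoidAlgebra.single 1 a * SkewMonoidAlgebra.single h (1 : A) := by
  simp [SkewMonoidAlgebra.single_mul_single]

lemma incl_mul_single (h : G) (a : A) :
    SkewMonoidAlgebra.single 1 (h⁻¹ • a) * SkewMonoidAlgebra.single h⁻¹ (1 : A) =
      SkewMonoidAlgebra.single h⁻¹ (1 : A) * SkewMonoidAlgebra.single 1 a := by
  simp [SkewMonoidAlgebra.single_mul_single]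

/-- This makes multiplication by h ⊗ h⁻¹ a map of A-bimodules once its source is twisted by h⁻¹. -/
lemma envConj_mul_envMap (h : G) (a : A) (b : Aᵐᵒᵖ) :
    envConj k A h * envMap (skewIncl k A G)
        (envMap (MulSemiringAction.toAlgHom k A h⁻¹) (a ⊗ₜ[k] b)) =
      envMap (skewIncl k A G) (a ⊗ₜ[k] b) * envConj k A h := by
  change (SkewMonoidAlgebra.single h 1 ⊗ₜ[k] MulOpposite.op (SkewMonoidAlgebra.single h⁻¹ 1) :
      Env k (SkewMonoidAlgebra A G)) * (SkewMonoidAlgebra.single 1 (h⁻¹ • a) ⊗ₜ[k]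
        MulOpposite.op (SkewMonoidAlgebra.single 1 (h⁻¹ • b.unop))) =
    (SkewMonoidAlgebra.single 1 a ⊗ₜ[k] MulOpposite.op (SkewMonoidAlgebra.single 1 b.unop)) *
      (SkewMonoidAlgebra.single h 1 ⊗ₜ[k] MulOpposite.op (SkewMonoidAlgebra.single h⁻¹ 1))
  rw [Algebra.TensorProduct.tmul_mul_tmul, Algebra.TensorProduct.tmul_mul_tmul,
    ← MulOpposite.op_mul, ← MulOpposite.op_mul, single_mul_incl, incl_mul_single]

lemma envConj_mul (g h : G) : envConj k A g * envConj k A h = envConj k A (g * h) := by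
  rw [envConj, envConj, envConj, Algebra.TensorProduct.tmul_mul_tmul, ← MulOpposite.op_mul]
  simp [SkewMonoidAlgebra.single_mul_single]

variable (k A) in
/-- Conjugation by `h` on the restrictions of `A ⋊ G`-bimodules to `A`. -/
def conjNat (h : G) :
    resBimod (skewIncl k A G) ⋙ resBimod (MulSemiringAction.toAlgHom k A h⁻¹) ⟶
      resBimod (skewIncl k A G) where
  app M := mkBimodHom
    (M := (resBimod (MulSemiringAction.toAlgHom k A h⁻¹)).obj ((resBimod (skewIncl k A G)).obj M))
    (N := (resBimod (skewIncl k A G)).obj M)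
    (show M →+ M from DistribSMul.toAddMonoidHom M (envConj k A h)) (fun a b c => by
      change envConj k A h • (envMap (skewIncl k A G)
        (envMap (MulSemiringAction.toAlgHom k A h⁻¹) (a ⊗ₜ[k] b)) • (show M from c)) =
        envMap (skewIncl k A G) (a ⊗ₜ[k] b) • (envConj k A h • (show M from c))
      rw [smul_smul, smul_smul, envConj_mul_envMap])
  naturality M N φ := ModuleCat.hom_ext (LinearMap.ext fun y =>
    (φ.hom.map_smul (envConj k A h) (show M from y)).symm)

/-- The action of `h` on the cohomology of `A` with coefficients in an `A ⋊ G`-bimodule. -/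
def conjAct (M : ModuleCat.{u} (Env k (SkewMonoidAlgebra A G))) (m : ℕ) (h : G) :
    HH k A ((resBimod (skewIncl k A G)).obj M) m →ₗ[k]
      HH k A ((resBimod (skewIncl k A G)).obj M) m where
  toFun e := (Ext.mk₀ (resBimodUnit (MulSemiringAction.toAlgHom k A h⁻¹))).comp
    ((e.mapExactFunctor (resBimod (MulSemiringAction.toAlgHom k A h⁻¹))).comp
      (Ext.mk₀ ((conjNat k A h).app M)) (add_zero m)) (zero_add m)
  map_add' e e' := by simp
  map_smul' c e := by simp

/-- Dimension shifting changes the coefficients, so the action is studied for an arbitrary bimodule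
over A ⋊ G; this recovers the case of the theorem. -/
lemma skewAct_eq_conjAct (m : ℕ) (h : G) :
    skewAct k A m h = conjAct (selfBimod k (SkewMonoidAlgebra A G)) m h := by
  have h1 : skewConj k A h = (conjNat k A h).app (selfBimod k (SkewMonoidAlgebra A G)) :=
    ModuleCat.hom_ext (LinearMap.ext fun y =>
      mul_assoc (SkewMonoidAlgebra.single h (1 : A)) (show SkewMonoidAlgebra A G from y)
        (SkewMonoidAlgebra.single h⁻¹ 1))
  refine LinearMap.ext fun e => ?_
  simp only [skewAct, conjAct, h1, LinearMap.coe_mk, AddHom.coe_mk]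

variable {M N : ModuleCat.{u} (Env k (SkewMonoidAlgebra A G))}

/-- The action commutes with composition by any class `x` that is compatible with conjugation. It is
applied to bimodule maps and to extension classes. -/
lemma conjAct_comp {m n l : ℕ} (h : G)
    (e : HH k A ((resBimod (skewIncl k A G)).obj M) m)
    (x : Ext.{u} ((resBimod (skewIncl k A G)).obj M) ((resBimod (skewIncl k A G)).obj N) n)
    (hx : (x.mapExactFunctor (resBimod (MulSemiringAction.toAlgHom k A h⁻¹))).comp
        (Ext.mk₀ ((conjNat k A h).app N)) (add_zero n) =
      (Ext.mk₀ ((conjNat k A h).app M)).comp x (zero_add n)) (hl : m + n = l) :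
    conjAct N l h (e.comp x hl) = (conjAct M m h e).comp x hl := by
  simp only [conjAct, LinearMap.coe_mk, AddHom.coe_mk]
  rw [Ext.mapExactFunctor_comp, Ext.comp_assoc _ _ _ hl (add_zero n) (by omega), hx,
    ← Ext.comp_assoc _ _ _ (add_zero m) (zero_add n) (by omega),
    Ext.comp_assoc _ _ _ (zero_add m) hl (by omega)]

lemma conjAct_postcomp (h : G) (φ : M ⟶ N) (m : ℕ)
    (e : HH k A ((resBimod (skewIncl k A G)).obj M) m) :
    conjAct N m h (e.comp (Ext.mk₀ ((resBimod (skewIncl k A G)).map φ)) (add_zero m)) =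
      (conjAct M m h e).comp (Ext.mk₀ ((resBimod (skewIncl k A G)).map φ)) (add_zero m) := by
  refine conjAct_comp h e _ ?_ _
  rw [Ext.mapExactFunctor_mk₀, Ext.mk₀_comp_mk₀, Ext.mk₀_comp_mk₀]
  exact congrArg Ext.mk₀ ((conjNat k A h).naturality φ)

variable {S : ShortComplex (ModuleCat.{u} (Env k (SkewMonoidAlgebra A G)))} (hS : S.ShortExact)

/-- The extension class of the restriction of a short exact sequence to `A`. -/
def resExtClass : Ext.{u} ((resBimod (skewIncl k A G)).obj S.X₃)
    ((resBimod (skewIncl k A G)).obj S.X₁) 1 :=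
  (hS.map_of_exact (resBimod (skewIncl k A G))).extClass

lemma mapExactFunctor_extClass :
    hS.extClass.mapExactFunctor (resBimod (skewIncl k A G)) = resExtClass hS :=
  Ext.mapExactFunctor_extClass _ hS

/-- Conjugation is a natural transformation, hence a map of short exact sequences, and extension
classes are natural for such maps. -/
lemma conjAct_comp_resExtClass (h : G) (m : ℕ)
    (e : HH k A ((resBimod (skewIncl k A G)).obj S.X₃) m) :
    conjAct S.X₁ (m + 1) h (e.comp (resExtClass hS) rfl) =
      (conjAct S.X₃ m h e).comp (resExtClass hS) rfl := by
  refine conjAct_comp h e _ ?_ _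
  have h1 : (resExtClass hS).mapExactFunctor (resBimod (MulSemiringAction.toAlgHom k A h⁻¹)) =
      ((hS.map_of_exact (resBimod (skewIncl k A G))).map_of_exact
        (resBimod (MulSemiringAction.toAlgHom k A h⁻¹))).extClass :=
    Ext.mapExactFunctor_extClass _ _
  rw [h1]
  exact ShortComplex.ShortExact.extClass_naturality
    ((hS.map_of_exact (resBimod (skewIncl k A G))).map_of_exact
      (resBimod (MulSemiringAction.toAlgHom k A h⁻¹)))
    (hS.map_of_exact (resBimod (skewIncl k A G))) (S.mapNatTrans (conjNat k A h))

/-- The connecting map is onto because Ext in positive degree into the injective middle term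
vanishes. -/
lemma exists_comp_resExtClass [Injective ((resBimod (skewIncl k A G)).obj S.X₂)] {m : ℕ}
    (v : HH k A ((resBimod (skewIncl k A G)).obj S.X₁) (m + 1)) :
    ∃ w : HH k A ((resBimod (skewIncl k A G)).obj S.X₃) m, w.comp (resExtClass hS) rfl = v :=
  Ext.covariant_sequence_exact₁ _ (hS.map_of_exact (resBimod (skewIncl k A G))) v
    (Ext.eq_zero_of_injective (I := (resBimod (skewIncl k A G)).obj S.X₂) _) rfl

lemma exists_postcomp_of_comp_resExtClass {m : ℕ}
    (w : HH k A ((resBimod (skewIncl k A G)).obj S.X₃) m)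
    (hw : w.comp (resExtClass hS) rfl = 0) :
    ∃ v : HH k A ((resBimod (skewIncl k A G)).obj S.X₂) m,
      v.comp (Ext.mk₀ ((resBimod (skewIncl k A G)).map S.g)) (add_zero m) = w :=
  Ext.covariant_sequence_exact₃ _ (hS.map_of_exact (resBimod (skewIncl k A G))) w rfl hw

lemma conjAct_mk₀ (h : G) (f : selfBimod k A ⟶ (resBimod (skewIncl k A G)).obj M) :
    conjAct M 0 h (Ext.mk₀ f) =
      Ext.mk₀ (resBimodUnit (MulSemiringAction.toAlgHom k A h⁻¹) ≫
        (resBimod (MulSemiringAction.toAlgHom k A h⁻¹)).map f ≫ (conjNat k A h).app M) := by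
  simp only [conjAct, LinearMap.coe_mk, AddHom.coe_mk]
  rw [Ext.mapExactFunctor_mk₀, Ext.mk₀_comp_mk₀, Ext.mk₀_comp_mk₀]


lemma conjAct_mk₀_eq {h : G} {f f' : selfBimod k A ⟶ (resBimod (skewIncl k A G)).obj M}
    (hf : ∀ c : A, envConj k A h • (show M from f.hom (selfElt k (h⁻¹ • c))) =
      (show M from f'.hom (selfElt k c))) :
    conjAct M 0 h (Ext.mk₀ f) = Ext.mk₀ f' := by
  rw [conjAct_mk₀]
  exact congrArg Ext.mk₀ (ModuleCat.hom_ext (LinearMap.ext hf))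

/-- The morphism `c ↦ (h ⊗ h⁻¹) f(h⁻¹ c)`. -/
def conjHom (h : G) (f : selfBimod k A ⟶ (resBimod (skewIncl k A G)).obj M) :
    selfBimod k A ⟶ (resBimod (skewIncl k A G)).obj M :=
  resBimodUnit (MulSemiringAction.toAlgHom k A h⁻¹) ≫
    (resBimod (MulSemiringAction.toAlgHom k A h⁻¹)).map f ≫ (conjNat k A h).app M

lemma conjHom_apply (h : G) (f : selfBimod k A ⟶ (resBimod (skewIncl k A G)).obj M) (c : A) :
    (show M from (conjHom h f).hom (selfElt k c)) =
      envConj k A h • (show M from f.hom (selfElt k (h⁻¹ • c))) := rfl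

lemma conjAct_mul_zero (g h : G) (v : HH k A ((resBimod (skewIncl k A G)).obj M) 0) :
    conjAct M 0 g (conjAct M 0 h v) = conjAct M 0 (g * h) v := by
  obtain ⟨f, rfl⟩ := (Ext.mk₀_bijective _ _).2 v
  rw [conjAct_mk₀ h]
  change conjAct M 0 g (Ext.mk₀ (conjHom h f)) = _
  rw [conjAct_mk₀ (g * h)]
  refine conjAct_mk₀_eq (f' := conjHom (g * h) f) fun c => ?_
  rw [conjHom_apply, conjHom_apply, smul_smul, envConj_mul, smul_smul, mul_inv_rev]

lemma conjAct_resHH_zero (h : G)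
    (e : HH k (SkewMonoidAlgebra A G) M 0) :
    conjAct M 0 h (resHH (skewIncl k A G) M 0 e) = resHH (skewIncl k A G) M 0 e := by
  obtain ⟨φ, rfl⟩ := (Ext.mk₀_bijective _ _).2 e
  rw [resHH_mk₀]
  refine conjAct_mk₀_eq fun c => ?_
  change envConj k A h • φ.hom (selfElt k (skewIncl k A G (h⁻¹ • c))) =
    φ.hom (selfElt k (skewIncl k A G c))
  rw [← map_smul, envConj, smul_selfElt]
  congr 2
  change SkewMonoidAlgebra.single h 1 * SkewMonoidAlgebra.single 1 (h⁻¹ • c) *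
    SkewMonoidAlgebra.single h⁻¹ 1 = SkewMonoidAlgebra.single 1 c
  simp [SkewMonoidAlgebra.single_mul_single]

/-- A bimodule map out of A ⋊ G is determined by its value at 1, which already lies in A. -/
lemma resHH_zero_injective : Function.Injective (resHH (skewIncl k A G) M 0) := by
  rw [injective_iff_map_eq_zero]
  intro e he
  obtain ⟨φ, rfl⟩ := (Ext.mk₀_bijective _ _).2 e
  rw [resHH_mk₀] at he
  have h0 := (Ext.mk₀_bijective _ _).1 (he.trans (Ext.mk₀_zero _ _).symm)
  have h1 : φ.hom (selfElt k (1 : SkewMonoidAlgebra A G)) = 0 :=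
    (congrArg φ.hom (congrArg (selfElt k) (map_one (skewIncl k A G)).symm)).trans
      (LinearMap.congr_fun (congrArg ModuleCat.Hom.hom h0) (selfElt k (1 : A)))
  have h2 : φ = 0 := ModuleCat.hom_ext (LinearMap.ext fun b => by
    have h3 : b = ((show SkewMonoidAlgebra A G from b) ⊗ₜ[k] 1 : Env k (SkewMonoidAlgebra A G)) •
        selfElt k (1 : SkewMonoidAlgebra A G) := by
      rw [smul_selfElt, mul_one, MulOpposite.unop_one, mul_one]
      rfl
    rw [h3, map_smul, h1, smul_zero]
    rfl)
  rw [h2, Ext.mk₀_zero]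

lemma left_smul_eq_right_smul (f : selfBimod k A ⟶ (resBimod (skewIncl k A G)).obj M) (a : A) :
    (skewIncl k A G a ⊗ₜ[k] 1 : Env k (SkewMonoidAlgebra A G)) •
      (show M from f.hom (selfElt k (1 : A))) = (show M from f.hom (selfElt k a)) ∧
    (1 ⊗ₜ[k] MulOpposite.op (skewIncl k A G a) : Env k (SkewMonoidAlgebra A G)) •
      (show M from f.hom (selfElt k (1 : A))) = (show M from f.hom (selfElt k a)) := by
  constructor
  · have h := f.hom.map_smul (a ⊗ₜ[k] 1 : Env k A) (selfElt k (1 : A))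
    rw [smul_selfElt, mul_one, MulOpposite.unop_one, mul_one] at h
    refine Eq.trans ?_ h.symm
    change _ = envMap (skewIncl k A G) (a ⊗ₜ[k] 1) • (show M from f.hom (selfElt k (1 : A)))
    rw [envMap, Algebra.TensorProduct.map_tmul, map_one]
  · have h := f.hom.map_smul (1 ⊗ₜ[k] MulOpposite.op a : Env k A) (selfElt k (1 : A))
    rw [smul_selfElt, mul_one, MulOpposite.unop_op, one_mul] at h
    refine Eq.trans ?_ h.symm
    change _ = envMap (skewIncl k A G) (1 ⊗ₜ[k] MulOpposite.op a) •
      (show M from f.hom (selfElt k (1 : A)))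
    rw [envMap, Algebra.TensorProduct.map_tmul, map_one]
    rfl

/-- The value y = f(1) commutes with A because f is a map of A-bimodules, and with G because it is
fixed by conjugation; these generate A ⋊ G. -/
lemma central_of_invariant (f : selfBimod k A ⟶ (resBimod (skewIncl k A G)).obj M)
    (hf : ∀ h : G, envConj k A h • (show M from f.hom (selfElt k (1 : A))) =
      (show M from f.hom (selfElt k (1 : A)))) (b : SkewMonoidAlgebra A G) :
    (1 ⊗ₜ[k] MulOpposite.op b : Env k (SkewMonoidAlgebra A G)) •
      (show M from f.hom (selfElt k (1 : A))) =
    (b ⊗ₜ[k] 1 : Env k (SkewMonoidAlgebra A G)) • (show M from f.hom (selfElt k (1 : A))) := by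
  set y : M := f.hom (selfElt k (1 : A)) with hy
  induction b using SkewMonoidAlgebra.induction_on with
  | zero => simp
  | add b b' hb hb' =>
    rw [MulOpposite.op_add, TensorProduct.tmul_add, TensorProduct.add_tmul, add_smul, add_smul,
      hb, hb']
  | single g a =>
    have h1 : (1 ⊗ₜ[k] MulOpposite.op (SkewMonoidAlgebra.single g (1 : A)) :
        Env k (SkewMonoidAlgebra A G)) • y = (SkewMonoidAlgebra.single g 1 ⊗ₜ[k] 1 :
        Env k (SkewMonoidAlgebra A G)) • y := by
      -- Replacing y by g y g⁻¹ turns y g into g y.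
      conv_lhs => rw [← hf g, smul_smul, envConj, Algebra.TensorProduct.tmul_mul_tmul,
        ← MulOpposite.op_mul]
      simp [SkewMonoidAlgebra.single_mul_single]
    have h2 : SkewMonoidAlgebra.single g a =
        skewIncl k A G a * SkewMonoidAlgebra.single g (1 : A) := by
      change _ = SkewMonoidAlgebra.single 1 a * _
      simp [SkewMonoidAlgebra.single_mul_single]
    have h3 := (left_smul_eq_right_smul f a).1.trans (left_smul_eq_right_smul f a).2.symm
    have h4 : (1 ⊗ₜ[k] MulOpposite.op (SkewMonoidAlgebra.single g a) :
        Env k (SkewMonoidAlgebra A G)) =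
        1 ⊗ₜ[k] MulOpposite.op (SkewMonoidAlgebra.single g (1 : A)) *
        1 ⊗ₜ[k] MulOpposite.op (skewIncl k A G a) := by
      rw [h2, Algebra.TensorProduct.tmul_mul_tmul, MulOpposite.op_mul, one_mul]
    have h5 : (SkewMonoidAlgebra.single g a ⊗ₜ[k] 1 : Env k (SkewMonoidAlgebra A G)) =
        skewIncl k A G a ⊗ₜ[k] 1 * SkewMonoidAlgebra.single g (1 : A) ⊗ₜ[k] 1 := by
      rw [h2, Algebra.TensorProduct.tmul_mul_tmul, one_mul]
    rw [h4, h5, mul_smul, mul_smul, ← h3, ← h1, smul_smul, smul_smul,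
      Algebra.TensorProduct.tmul_mul_tmul, Algebra.TensorProduct.tmul_mul_tmul]
    simp only [one_mul, mul_one]
    rfl

lemma exists_resHH_zero (v : HH k A ((resBimod (skewIncl k A G)).obj M) 0)
    (hv : ∀ h : G, conjAct M 0 h v = v) : ∃ e, resHH (skewIncl k A G) M 0 e = v := by
  obtain ⟨f, rfl⟩ := (Ext.mk₀_bijective _ _).2 v
  have hf : ∀ h : G, envConj k A h • (show M from f.hom (selfElt k (1 : A))) =
      (show M from f.hom (selfElt k (1 : A))) := fun h => by
    have h1 := hv h
    rw [conjAct_mk₀] at h1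
    have h2 := LinearMap.congr_fun
      (congrArg ModuleCat.Hom.hom ((Ext.mk₀_bijective _ _).1 h1)) (selfElt k (1 : A))
    refine Eq.trans ?_ h2
    change _ = (show M from (conjHom h f).hom (selfElt k 1))
    rw [conjHom_apply, smul_one]
  -- The extension of f is b ↦ b f(1); centrality of f(1) makes it linear on the right too.
  let φ : selfBimod k (SkewMonoidAlgebra A G) ⟶ M :=
    mkBimodHom
      (show SkewMonoidAlgebra A G →+ M from
        { toFun := fun b => (b ⊗ₜ[k] 1 : Env k (SkewMonoidAlgebra A G)) •
            (show M from f.hom (selfElt k (1 : A)))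
          map_zero' := by rw [TensorProduct.zero_tmul, zero_smul]
          map_add' := fun b b' => by rw [TensorProduct.add_tmul, add_smul] })
      (fun a b c => by
        change ((a * ((show SkewMonoidAlgebra A G from c) * b.unop)) ⊗ₜ[k] 1 :
          Env k (SkewMonoidAlgebra A G)) • (show M from f.hom (selfElt k (1 : A))) =
          (a ⊗ₜ[k] b : Env k (SkewMonoidAlgebra A G)) •
            (((show SkewMonoidAlgebra A G from c) ⊗ₜ[k] 1 : Env k (SkewMonoidAlgebra A G)) •
            (show M from f.hom (selfElt k (1 : A))))
        have h1 := central_of_invariant f hf b.unop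
        have h2 : ((a * ((show SkewMonoidAlgebra A G from c) * b.unop)) ⊗ₜ[k] 1 :
            Env k (SkewMonoidAlgebra A G)) =
            (a * (show SkewMonoidAlgebra A G from c)) ⊗ₜ[k] 1 * b.unop ⊗ₜ[k] 1 := by
          rw [Algebra.TensorProduct.tmul_mul_tmul, mul_assoc, one_mul]
        rw [h2, mul_smul, ← h1, smul_smul, smul_smul, Algebra.TensorProduct.tmul_mul_tmul,
          Algebra.TensorProduct.tmul_mul_tmul, MulOpposite.op_unop]
        simp only [one_mul, mul_one])
  refine ⟨Ext.mk₀ φ, ?_⟩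
  rw [resHH_mk₀]
  exact congrArg Ext.mk₀ (ModuleCat.hom_ext (LinearMap.ext fun a =>
    (left_smul_eq_right_smul f a).1))

/-- In degree `m`, the maps `conjAct` are multiplicative in the group element, and restriction to
`A` is injective with the invariants as its image. -/
structure ResInvariants (k : Type u) [Field k] (A : Type u) [Ring A] [Algebra k A]
    (G : Type u) [Group G] [MulSemiringAction G A] [SMulCommClass G k A] (m : ℕ) : Prop where
  act_mul : ∀ (M : ModuleCat.{u} (Env k (SkewMonoidAlgebra A G))) (g h : G)
    (v : HH k A ((resBimod (skewIncl k A G)).obj M) m),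
    conjAct M m g (conjAct M m h v) = conjAct M m (g * h) v
  act_res : ∀ (M : ModuleCat.{u} (Env k (SkewMonoidAlgebra A G))) (h : G)
    (e : HH k (SkewMonoidAlgebra A G) M m),
    conjAct M m h (resHH (skewIncl k A G) M m e) = resHH (skewIncl k A G) M m e
  injective : ∀ M : ModuleCat.{u} (Env k (SkewMonoidAlgebra A G)),
    Function.Injective (resHH (skewIncl k A G) M m)
  exists_res : ∀ (M : ModuleCat.{u} (Env k (SkewMonoidAlgebra A G)))
    (v : HH k A ((resBimod (skewIncl k A G)).obj M) m),
    (∀ h : G, conjAct M m h v = v) → ∃ e, resHH (skewIncl k A G) M m e = v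

lemma resInvariants_zero : ResInvariants k A G 0 :=
  ⟨fun _ => conjAct_mul_zero, fun _ => conjAct_resHH_zero, fun _ => resHH_zero_injective,
    fun _ => exists_resHH_zero⟩

variable [Finite G]

/-- Averaging over the group. -/
def average (M : ModuleCat.{u} (Env k (SkewMonoidAlgebra A G))) (m : ℕ) :
    HH k A ((resBimod (skewIncl k A G)).obj M) m →ₗ[k]
      HH k A ((resBimod (skewIncl k A G)).obj M) m :=
  letI := Fintype.ofFinite G
  (Fintype.card G : k)⁻¹ • ∑ h : G, conjAct M m h

lemma average_apply [Fintype G] {m : ℕ} (v : HH k A ((resBimod (skewIncl k A G)).obj M) m) :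
    average M m v = (Fintype.card G : k)⁻¹ • ∑ h : G, conjAct M m h v := by
  rw [average, LinearMap.smul_apply, LinearMap.sum_apply]
  congr!

/-- Characteristic 0 enters here: the order of G must be invertible. -/
lemma average_eq_self [CharZero k] {m : ℕ} (v : HH k A ((resBimod (skewIncl k A G)).obj M) m)
    (hv : ∀ h : G, conjAct M m h v = v) : average M m v = v := by
  let := Fintype.ofFinite G
  rw [average_apply, Finset.sum_congr rfl fun h _ => hv h, Finset.sum_const, Finset.card_univ,
    ← Nat.cast_smul_eq_nsmul k, smul_smul,
    inv_mul_cancel₀ (Nat.cast_ne_zero.2 Fintype.card_ne_zero), one_smul]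

lemma ResInvariants.act_average {m : ℕ} (hm : ResInvariants k A G m) (g : G)
    (v : HH k A ((resBimod (skewIncl k A G)).obj M) m) :
    conjAct M m g (average M m v) = average M m v := by
  let := Fintype.ofFinite G
  rw [average_apply, map_smul, map_sum, Finset.sum_congr rfl fun h _ => hm.act_mul M g h v]
  congr 1
  exact Fintype.sum_equiv (Equiv.mulLeft g) _ _ fun _ => rfl

lemma ResInvariants.exists_res_eq_average {m : ℕ} (hm : ResInvariants k A G m)
    (v : HH k A ((resBimod (skewIncl k A G)).obj M) m) :
    ∃ e, resHH (skewIncl k A G) M m e = average M m v :=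
  hm.exists_res M _ fun h => hm.act_average h v

lemma average_comp_resExtClass {m : ℕ} (e : HH k A ((resBimod (skewIncl k A G)).obj S.X₃) m) :
    average S.X₁ (m + 1) (e.comp (resExtClass hS) rfl) =
      (average S.X₃ m e).comp (resExtClass hS) rfl := by
  let := Fintype.ofFinite G
  rw [average_apply, average_apply, Ext.smul_comp, Ext.sum_comp]
  simp only [conjAct_comp_resExtClass]

lemma average_postcomp (φ : M ⟶ N) {m : ℕ}
    (e : HH k A ((resBimod (skewIncl k A G)).obj M) m) :
    average N m (e.comp (Ext.mk₀ ((resBimod (skewIncl k A G)).map φ)) (add_zero m)) =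
      (average M m e).comp (Ext.mk₀ ((resBimod (skewIncl k A G)).map φ)) (add_zero m) := by
  let := Fintype.ofFinite G
  rw [average_apply, average_apply, Ext.smul_comp, Ext.sum_comp]
  simp only [conjAct_postcomp]

/-- All four properties are carried together: surjectivity onto invariants in degree m supplies
lifts of averages, and averages are invariant only because the action is multiplicative. The
connecting maps commute with restriction (`res`) and with the action. -/
lemma ResInvariants.succ [CharZero k] {m : ℕ} (hm : ResInvariants k A G m) :
    ResInvariants k A G (m + 1) := by
  have key : ∀ M : ModuleCat.{u} (Env k (SkewMonoidAlgebra A G)),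
      ∃ (I N : ModuleCat.{u} (Env k (SkewMonoidAlgebra A G))) (i : M ⟶ I) (p : I ⟶ N)
        (w : i ≫ p = 0), (ShortComplex.mk i p w).ShortExact ∧ Injective I ∧
        Injective ((resBimod (skewIncl k A G)).obj I) := exists_injective_embedding k A G
  have lift : ∀ {S : ShortComplex (ModuleCat.{u} (Env k (SkewMonoidAlgebra A G)))}
      (hS : S.ShortExact) (_ : Injective S.X₂) (e : HH k (SkewMonoidAlgebra A G) S.X₁ (m + 1)),
      ∃ w : HH k (SkewMonoidAlgebra A G) S.X₃ m, w.comp hS.extClass rfl = e := fun hS _ e =>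
    Ext.covariant_sequence_exact₁ _ hS e (Ext.eq_zero_of_injective _) rfl
  have res : ∀ {S : ShortComplex (ModuleCat.{u} (Env k (SkewMonoidAlgebra A G)))}
      (hS : S.ShortExact) (w : HH k (SkewMonoidAlgebra A G) S.X₃ m),
      resHH (skewIncl k A G) S.X₁ (m + 1) (w.comp hS.extClass rfl) =
        (resHH (skewIncl k A G) S.X₃ m w).comp (resExtClass hS) rfl := fun hS w => by
    rw [resHH_comp, mapExactFunctor_extClass]
  refine ⟨fun M g h v => ?_, fun M h e => ?_, fun M => ?_, fun M v hv => ?_⟩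
  all_goals obtain ⟨I, N, i, p, w, hS, hI, hI'⟩ := key M
  · obtain ⟨v', rfl⟩ := exists_comp_resExtClass hS v
    have h1 := conjAct_comp_resExtClass hS h m v'
    have h2 := conjAct_comp_resExtClass hS (g * h) m v'
    have h3 := conjAct_comp_resExtClass hS g m (conjAct N m h v')
    exact (congrArg (conjAct M (m + 1) g) h1).trans (h3.trans
      ((congrArg (fun x => Ext.comp x (resExtClass hS) rfl) (hm.act_mul N g h v')).trans h2.symm))
  · obtain ⟨e', rfl⟩ := lift hS hI e
    have h1 := conjAct_comp_resExtClass hS h m (resHH (skewIncl k A G) N m e')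
    rw [hm.act_res N, ← res hS e'] at h1
    exact h1
  · rw [injective_iff_map_eq_zero]
    intro e he
    obtain ⟨e', rfl⟩ := lift hS hI e
    -- If e = δe' restricts to zero, the restriction of e' comes from some v with coefficients in
    -- the injective bimodule I. The average of v is a restriction of some c, and averaging fixes
    -- the restriction of e', so c maps to e' by injectivity in degree m. Hence δe' = 0.
    obtain ⟨v, hv⟩ := exists_postcomp_of_comp_resExtClass hS _ ((res hS e').symm.trans he)
    obtain ⟨c, hc⟩ := hm.exists_res_eq_average v
    have h1 := average_postcomp p v
    have h2 : c.comp (Ext.mk₀ p) (add_zero m) = e' := hm.injective N (by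
      rw [resHH_comp, Ext.mapExactFunctor_mk₀, hc, ← h1]
      refine (congrArg (average N m) hv).trans (average_eq_self _ fun h => hm.act_res N h e'))
    rw [← h2]
    exact (Ext.comp_assoc_of_second_deg_zero _ _ _ _).trans
      ((congrArg (fun x => Ext.comp c x rfl) hS.comp_extClass).trans (Ext.comp_zero _ _ _ _ _))
  · obtain ⟨v', rfl⟩ := exists_comp_resExtClass hS v
    -- The preimage v' of v need not be invariant, but its average also maps to v, because v is its
    -- own average.
    obtain ⟨c, hc⟩ := hm.exists_res_eq_average v'
    refine ⟨c.comp hS.extClass rfl, (res hS c).trans ?_⟩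
    refine (congrArg (fun x => Ext.comp x (resExtClass hS) rfl) hc).trans ?_
    exact (average_comp_resExtClass hS v').symm.trans (average_eq_self _ hv)

variable (k A G) in
lemma resInvariants [CharZero k] (m : ℕ) : ResInvariants k A G m := by
  induction m with
  | zero => exact resInvariants_zero
  | succ m hm => exact hm.succ

variable (k A G) in
lemma range_resHH [CharZero k] (m : ℕ) :
    LinearMap.range (resHH (skewIncl k A G) (selfBimod k (SkewMonoidAlgebra A G)) m) =
      skewInvariants k A G m := by
  ext v
  simp only [skewInvariants, Submodule.mem_iInf, LinearMap.mem_eqLocus, LinearMap.mem_range,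
    skewAct_eq_conjAct, LinearMap.id_apply]
  refine ⟨?_, (resInvariants k A G m).exists_res _ v⟩
  rintro ⟨e, rfl⟩ h
  exact (resInvariants k A G m).act_res _ h e

end Invariants

end HHQuantum
end

theorem theorem3p2 {k : Type u} [Field k] [CharZero k] {n : ℕ} (q : QCoeff k n)
    {G : Type u} [Group G] [Finite G] [MulSemiringAction G (QCI q)] [SMulCommClass G k (QCI q)]
    (χ : G → Fin n → k) (hχ : ∀ g i, g • QCI.x q i = χ g i • QCI.x q i) :
    ∃ hK : QuasiIso (QCI.Kπ q), ∀ m : ℕ,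
      ∃ (hc : ∀ (g : G) (p : QCI.BIdx q (χ g) m),
          (QCI.K q).d (m + 1) m ≫ QCI.cochain q g p.1.1 p.1.2 = 0)
        (b : ∀ g : G, Module.Basis (QCI.BIdx q (χ g) m) k
          (HH k (QCI q) (twistBimod k (QCI q) g) m))
        (B : Module.Basis (Σ g : G, QCI.BIdx q (χ g) m) k
          (HH k (QCI q) (skewBimod k (QCI q) G) m)),
        (∀ g p, b g p =
          (QCI.Kres q hK).extMk (QCI.cochain q g p.1.1 p.1.2) (m + 1) rfl (hc g p)) ∧
        (∀ g p, B ⟨g, p⟩ =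
          (b g p).comp (Abelian.Ext.mk₀ (twistIncl k (QCI q) g)) (add_zero m)) ∧
        Function.Injective (resHH (skewIncl k (QCI q) G)
          (selfBimod k (SkewMonoidAlgebra (QCI q) G)) m) ∧
        LinearMap.range (resHH (skewIncl k (QCI q) G)
          (selfBimod k (SkewMonoidAlgebra (QCI q) G)) m) = skewInvariants k (QCI q) G m := by
  refine ⟨QCI.quasiIso_Kπ q, fun m => ⟨fun g p => QCI.d_cochain g (χ g) (hχ g) p,
    fun g => QCI.basisHH q g (χ g) (hχ g) m,
    skewBasis k (QCI q) m fun g => QCI.basisHH q g (χ g) (hχ g) m,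
    fun g p => QCI.basisHH_apply q g (χ g) (hχ g) m p,
    fun g p => skewBasis_apply k (QCI q) m (fun g => QCI.basisHH q g (χ g) (hχ g) m) g p,
    (resInvariants k (QCI q) G m).injective _, range_resHH k (QCI q) G m⟩⟩
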